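/- All graphs are finite and simple. A graph $G$ is \emph{$(k,d)$-colourable} if its vertices can be coloured with $k$ colours so that every vertex has at most $d$ neighbours of its own colour; it is \emph{$(k,d)$-choosable} if, whenever each vertex $v$ is given a set $L(v)$ of exactly $k$ colours, one can choose for each vertex $v$ a colour in $L(v)$ so that every vertex has at most $d$ neighbours of its own colour. The \emph{defective chromatic number} (respectively, \emph{defective choice number}) of a class of graphs is the minimum integer $k$ for which there is an integer $d$ such that every graph in the class is $(k,d)$-colourable (respectively, $(k,d)$-choosable). Let $s\ge 2$ be an integer. Then the class of $K_{s+1}$-minor-free graphs has defective chromatic number $s$ and defective choice number $s$. Moreover, the supremum $$\delta:=\sup\left\{\frac{|E(G)|}{|V(G)|} : G \text{ is a non-empty } K_{s+1}\text{-minor-free graph}\right\}$$ is finite, and every $K_{s+1}$-minor-free graph is $(s,d)$-choosable, where $d:=\lfloor\delta(2\delta-s+1)\rfloor-s+1$ is a non-negative integer. The same statements hold with ``topological minor'' in place of ``minor'' throughout (also in the definition of $\delta$). -/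

import Mathlib

universe u

namespace DefectiveColouring

/-- `H` is a minor of `G`: there are pairwise disjoint connected (in particular non-empty) branch
sets in `G`, one for each vertex of `H`, such that adjacent vertices of `H` have an edge of `G`
between their branch sets. (Contract each branch set to a vertex in a suitable subgraph.) -/
def IsMinor {W V : Type*} (H : SimpleGraph W) (G : SimpleGraph V) : Prop :=
  ∃ B : W → Set V,
    (∀ a, (G.induce (B a)).Connected) ∧
    (∀ a b, a ≠ b → Disjoint (B a) (B b)) ∧
    (∀ a b, H.Adj a b → ∃ x ∈ B a, ∃ y ∈ B b, G.Adj x y)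

/-- `H` is a topological minor of `G`: some subdivision of `H` is a subgraph of `G`. That is, the
vertices of `H` are mapped injectively to branch vertices of `G`, and the edges of `H` are replaced
by paths of `G` between the corresponding branch vertices, where a path contains no branch vertex
other than its two ends, and the paths of two distinct edges meet only in branch vertices.
(The two orientations of an edge may use the same path, reversed; no condition relates them.) -/
def IsTopologicalMinor {W V : Type*} (H : SimpleGraph W) (G : SimpleGraph V) : Prop :=
  ∃ (f : W ↪ V) (P : ∀ a b, H.Adj a b → G.Walk (f a) (f b)),
    (∀ a b (h : H.Adj a b), (P a b h).IsPath) ∧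
    (∀ a b (h : H.Adj a b) (c : W), f c ∈ (P a b h).support → c = a ∨ c = b) ∧
    (∀ a b (h : H.Adj a b) (a' b' : W) (h' : H.Adj a' b'), s(a, b) ≠ s(a', b') →
      ∀ x, x ∈ (P a b h).support → x ∈ (P a' b' h').support → ∃ c, x = f c)

/-- Every vertex has at most `d` neighbours of its own colour. -/
def HasDefect {V α : Type*} (G : SimpleGraph V) (c : V → α) (d : ℕ) : Prop :=
  ∀ v, {w | G.Adj v w ∧ c w = c v}.encard ≤ d

/-- `G` is `(k, d)`-colourable: `k`-colourable with defect `d`. -/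
def IsColourable {V : Type*} (G : SimpleGraph V) (k d : ℕ) : Prop :=
  ∃ c : V → Fin k, HasDefect G c d

/-- `G` is `(k, d)`-choosable: for every assignment of lists of exactly `k` colours to the
vertices, there is a colouring from the lists with defect `d`. -/
def IsChoosable {V : Type u} (G : SimpleGraph V) (k d : ℕ) : Prop :=
  ∀ (α : Type u) (L : V → Finset α), (∀ v, (L v).card = k) →
    ∃ c : V → α, (∀ v, c v ∈ L v) ∧ HasDefect G c d

/-- A class of graphs. Only its finite members matter below: all graphs are finite. -/
def GraphClass := ∀ V : Type u, SimpleGraph V → Prop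

/-- The class of graphs with no `H` minor. -/
def minorFree {W : Type} (H : SimpleGraph W) : GraphClass.{u} :=
  fun _ G => ¬ IsMinor H G

/-- The class of graphs with no `H` topological minor. -/
def topologicalMinorFree {W : Type} (H : SimpleGraph W) : GraphClass.{u} :=
  fun _ G => ¬ IsTopologicalMinor H G

/-- The defective chromatic number of `C` exists and equals `k`. -/
def HasDefectiveChromaticNumber (C : GraphClass.{u}) (k : ℕ) : Prop :=
  IsLeast {j : ℕ | ∃ d : ℕ, ∀ (V : Type u) [Finite V] (G : SimpleGraph V),
    C V G → IsColourable G j d} k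

/-- The defective choice number of `C` exists and equals `k`. -/
def HasDefectiveChoiceNumber (C : GraphClass.{u}) (k : ℕ) : Prop :=
  IsLeast {j : ℕ | ∃ d : ℕ, ∀ (V : Type u) [Finite V] (G : SimpleGraph V),
    C V G → IsChoosable G j d} k

/-- The set of the densities `|E(G)| / |V(G)|` of the finite non-empty graphs `G` in `C`. -/
def densities (C : GraphClass.{u}) : Set ℝ :=
  {x | ∃ (V : Type u) (_ : Finite V) (_ : Nonempty V) (G : SimpleGraph V),
    C V G ∧ x = (G.edgeSet.ncard : ℝ) / (Nat.card V : ℝ)}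

end DefectiveColouring

/-!
Both classes lie between the `K_{s+1}`-minor-free graphs and the graphs with no `K_{s+1}`
topological minor, and both are closed under subgraphs and under suppressing a vertex (deleting it
and joining two of its neighbours); only these properties matter. Their densities are bounded by
Mader's argument.

No fewer than `s` colours suffice: the cone over `d + 1` disjoint copies of a graph needs one colour
more than the graph itself at defect `d`, while its largest complete minor grows by one only.

Call a vertex low if its degree is less than `d + s`, and high otherwise. A low vertex with too many
neighbours of its colour can always be recoloured, so only the high vertices matter. A vertex is
reducible if, however the other vertices are coloured, its list has a colour that avoids its high
neighbours and, if it is high itself, is shared with at most `d` low ones; its edges can then be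
deleted by induction. Suppose that there are edges but no reducible vertex. Then every low vertex
that is not isolated has at least `s` high neighbours, two of which are non-adjacent as there is no
`K_{s+1}`. Hence the low vertices can be suppressed one after another, each adding an edge between
high vertices. The density bound for the resulting graph limits the number of low vertices, and then
the density bound for the original graph contradicts the degrees of the high vertices. For `s ≤ 3`
the bounds in terms of `δ` do not suffice, but suppression itself yields the sharper bound
`|E| ≤ (s - 1)(|V| - 1)`.
-/

namespace DefectiveColouring

/-! ### Reachability inside a set of vertices -/

/-- `y` can be reached from `x` by a walk of `G` that stays inside `T`. Unlike reachability in
`G.induce T`, this relates vertices of `G` itself. -/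
def ReachableIn {V : Type*} (G : SimpleGraph V) (T : Set V) (x y : V) : Prop :=
  ∃ p : G.Walk x y, ∀ z ∈ p.support, z ∈ T

namespace ReachableIn

variable {V : Type*} {G : SimpleGraph V} {T T' : Set V} {x y z : V}

theorem refl (hx : x ∈ T) : ReachableIn G T x x :=
  ⟨.nil, by simpa using hx⟩

theorem of_adj (hxy : G.Adj x y) (hx : x ∈ T) (hy : y ∈ T) : ReachableIn G T x y :=
  ⟨.cons hxy .nil, by simp [hx, hy]⟩

theorem symm : ReachableIn G T x y → ReachableIn G T y x := by
  rintro ⟨p, hp⟩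
  exact ⟨p.reverse, by simpa using hp⟩

theorem trans : ReachableIn G T x y → ReachableIn G T y z → ReachableIn G T x z := by
  rintro ⟨p, hp⟩ ⟨q, hq⟩
  refine ⟨p.append q, fun w hw => ?_⟩
  rw [SimpleGraph.Walk.mem_support_append_iff] at hw
  exact hw.elim (hp w) (hq w)

theorem mono (hT : T ⊆ T') : ReachableIn G T x y → ReachableIn G T' x y := by
  rintro ⟨p, hp⟩
  exact ⟨p, fun w hw => hT (hp w hw)⟩

theorem left_mem : ReachableIn G T x y → x ∈ T := by
  rintro ⟨p, hp⟩
  exact hp x p.start_mem_support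

theorem right_mem : ReachableIn G T x y → y ∈ T := by
  rintro ⟨p, hp⟩
  exact hp y p.end_mem_support

theorem induction {P : V → Prop} (h : ReachableIn G T x y) (hx : P x)
    (hstep : ∀ a b, G.Adj a b → a ∈ T → b ∈ T → P a → P b) : P y := by
  obtain ⟨p, hp⟩ := h
  induction p with
  | nil => exact hx
  | cons hab p ih =>
    refine ih (hstep _ _ hab (hp _ (by simp)) (hp _ (by simp)) hx) fun w hw => hp w ?_
    simp [hw]

theorem map {W : Type*} {H : SimpleGraph W} {S : Set W} {f : W → V} {a b : W}
    (h : ReachableIn H S a b) (ha : f a ∈ T)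
    (hstep : ∀ c d, H.Adj c d → c ∈ S → d ∈ S → ReachableIn G T (f c) (f d)) :
    ReachableIn G T (f a) (f b) :=
  h.induction (P := fun c => ReachableIn G T (f a) (f c)) (.refl ha)
    fun c d hcd hc hd hac => hac.trans (hstep c d hcd hc hd)

theorem setOf_reachableIn (h : ReachableIn G T x y) :
    ReachableIn G {z | ReachableIn G T x z} x y := by
  have hx : ReachableIn G T x x := .refl h.left_mem
  refine (h.induction (P := fun y => ReachableIn G T x y ∧
    ReachableIn G {z | ReachableIn G T x z} x y) ⟨hx, .refl hx⟩ ?_).2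
  rintro a b hab ha hb ⟨hxa, hxa'⟩
  have hxb : ReachableIn G T x b := hxa.trans (.of_adj hab ha hb)
  exact ⟨hxb, hxa'.trans (.of_adj hab hxa hxb)⟩

theorem exists_adj_right (h : ReachableIn G T x y) (hxy : x ≠ y) :
    ∃ z, ReachableIn G (T \ {y}) x z ∧ G.Adj z y := by
  obtain ⟨p, hp⟩ := h
  induction p with
  | nil => exact absurd rfl hxy
  | @cons a b c hab p ih =>
    have ha : a ∈ T \ {c} := ⟨hp a (by simp), hxy⟩
    rcases eq_or_ne b c with rfl | hbc
    · exact ⟨a, .refl ha, hab⟩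
    · obtain ⟨z, hz, hzc⟩ := ih hbc fun w hw => hp w (by simp [hw])
      exact ⟨z, (ReachableIn.of_adj hab ha hz.left_mem).trans hz, hzc⟩

end ReachableIn

section Induce

variable {V : Type*} {G : SimpleGraph V} {T : Set V} {x : V}

theorem induce_connected_iff : (G.induce T).Connected ↔
    T.Nonempty ∧ ∀ x ∈ T, ∀ y ∈ T, ReachableIn G T x y := by
  constructor
  · intro h
    refine ⟨Set.nonempty_coe_sort.1 h.nonempty, fun x hx y hy => ?_⟩
    obtain ⟨p⟩ := h.preconnected ⟨x, hx⟩ ⟨y, hy⟩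
    have hp : ReachableIn (G.induce T) Set.univ ⟨x, hx⟩ ⟨y, hy⟩ := ⟨p, fun _ _ => trivial⟩
    exact hp.map (f := Subtype.val) hx fun c d hcd _ _ => .of_adj hcd c.2 d.2
  · rintro ⟨hT, h⟩
    have := hT.to_subtype
    refine ⟨fun x y => ?_⟩
    obtain ⟨p, hp⟩ := h x x.2 y y.2
    exact ⟨p.induce T hp⟩

theorem induce_connected_of_root (hx : x ∈ T) (h : ∀ y ∈ T, ReachableIn G T x y) :
    (G.induce T).Connected :=
  induce_connected_iff.2 ⟨⟨x, hx⟩, fun y hy z hz => (h y hy).symm.trans (h z hz)⟩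

end Induce

/-! ### Minors and topological minors -/

/-- A subdivision of `H` in `G`, with its paths recorded only by sets of vertices: the end vertices
of an edge `e` are joined inside `route e`, and distinct routes meet only in branch vertices that
are ends of both edges. The value of `route` at a pair that is not an edge of `H` is unused, but has
to obey the disjointness conditions; it may be empty. -/
structure SubdivisionModel {W V : Type*} (H : SimpleGraph W) (G : SimpleGraph V) where
  branch : W ↪ V
  route : Sym2 W → Set V
  mem_of_branch_mem_route : ∀ {c e}, branch c ∈ route e → c ∈ e
  exists_branch_eq : ∀ {e e' x}, e ≠ e' → x ∈ route e → x ∈ route e' → ∃ c, branch c = x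
  reachableIn : ∀ {a b}, H.Adj a b → ReachableIn G (route s(a, b)) (branch a) (branch b)

section Minor

variable {W V U : Type*} {H : SimpleGraph W} {G : SimpleGraph V} {G' : SimpleGraph U}

theorem isTopologicalMinor_iff_nonempty_subdivisionModel :
    IsTopologicalMinor H G ↔ Nonempty (SubdivisionModel H G) := by
  classical
  constructor
  · rintro ⟨f, P, -, hbranch, hdisj⟩
    refine ⟨⟨f, fun e => {x | ∃ a b, ∃ h : H.Adj a b, e = s(a, b) ∧ x ∈ (P a b h).support},
      ?_, ?_, fun {a b} h => ⟨P a b h, fun z hz => ⟨a, b, h, rfl, hz⟩⟩⟩⟩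
    · rintro c _ ⟨a, b, h, rfl, hc⟩
      exact Sym2.mem_iff.2 (hbranch a b h c hc)
    · rintro _ _ x hne ⟨a, b, h, rfl, hx⟩ ⟨a', b', h', rfl, hx'⟩
      obtain ⟨c, rfl⟩ := hdisj a b h a' b' h' hne x hx hx'
      exact ⟨c, rfl⟩
  · rintro ⟨M⟩
    choose p hp using @M.reachableIn
    have hroute {a b} (h : H.Adj a b) : ∀ z ∈ (p h).bypass.support, z ∈ M.route s(a, b) :=
      fun z hz => hp h z ((p h).support_bypass_subset_support hz)
    refine ⟨M.branch, fun a b h => (p h).bypass, fun a b h => (p h).bypass_isPath,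
      fun a b h c hc => Sym2.mem_iff.1 (M.mem_of_branch_mem_route (hroute h _ hc)),
      fun a b h a' b' h' hne x hx hx' => ?_⟩
    obtain ⟨c, rfl⟩ := M.exists_branch_eq hne (hroute h x hx) (hroute h' x hx')
    exact ⟨c, rfl⟩

theorem IsTopologicalMinor.map (h : IsTopologicalMinor H G) (g : V ↪ U)
    (hg : ∀ x y, G.Adj x y → G'.Adj (g x) (g y)) : IsTopologicalMinor H G' := by
  rw [isTopologicalMinor_iff_nonempty_subdivisionModel] at h ⊢
  obtain ⟨M⟩ := h
  refine ⟨⟨M.branch.trans g, fun e => g '' M.route e, ?_, ?_, fun h =>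
    (M.reachableIn h).map (Set.mem_image_of_mem g (M.reachableIn h).left_mem)
      fun c d hcd hc hd => .of_adj (hg c d hcd) ⟨c, hc, rfl⟩ ⟨d, hd, rfl⟩⟩⟩
  · rintro c e ⟨x, hx, hxc⟩
    exact M.mem_of_branch_mem_route (g.injective hxc ▸ hx)
  · rintro e e' _ hne ⟨x, hx, rfl⟩ ⟨y, hy, hyx⟩
    obtain ⟨c, rfl⟩ := M.exists_branch_eq hne hx (g.injective hyx ▸ hy)
    exact ⟨c, rfl⟩

theorem IsMinor.map (h : IsMinor H G) (g : V ↪ U)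
    (hg : ∀ x y, G.Adj x y → G'.Adj (g x) (g y)) : IsMinor H G' := by
  obtain ⟨B, hconn, hdisj, hadj⟩ := h
  refine ⟨fun a => g '' B a, fun a => ?_, fun a b hab =>
    Set.disjoint_image_of_injective g.injective (hdisj a b hab), fun a b hab => ?_⟩
  · obtain ⟨⟨x, hx⟩, hreach⟩ := induce_connected_iff.1 (hconn a)
    refine induce_connected_of_root (Set.mem_image_of_mem g hx) ?_
    rintro _ ⟨y, hy, rfl⟩
    exact (hreach x hx y hy).map (Set.mem_image_of_mem g hx) fun c d hcd hc hd =>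
      .of_adj (hg c d hcd) (Set.mem_image_of_mem g hc) (Set.mem_image_of_mem g hd)
  · obtain ⟨x, hx, y, hy, hxy⟩ := hadj a b hab
    exact ⟨g x, Set.mem_image_of_mem g hx, g y, Set.mem_image_of_mem g hy, hg x y hxy⟩

namespace SubdivisionModel

variable [LinearOrder W] (M : SubdivisionModel H G) {a b : W} {z : V}

/-- The branch set of `a` in the minor obtained from a subdivision: the branch vertex together with
the routes to the later branch vertices, up to their last vertex. -/
def branchSet (a : W) : Set V :=
  insert (M.branch a)
    {z | ∃ b, a < b ∧ ReachableIn G (M.route s(a, b) \ {M.branch b}) (M.branch a) z}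

variable {M}

theorem eq_branch_or_mem_route_of_mem_branchSet (hz : z ∈ M.branchSet a) :
    z = M.branch a ∨ (∀ c, z ≠ M.branch c) ∧ ∃ b, a < b ∧ z ∈ M.route s(a, b) := by
  obtain hza | ⟨b, hab, hreach⟩ := hz
  · exact .inl hza
  · obtain ⟨hroute, hzb⟩ := hreach.right_mem
    by_cases! hbranch : ∃ c, z = M.branch c
    · obtain ⟨c, rfl⟩ := hbranch
      rcases Sym2.mem_iff.1 (M.mem_of_branch_mem_route hroute) with rfl | rfl
      · exact .inl rfl
      · exact absurd rfl hzb
    · exact .inr ⟨hbranch, b, hab, hroute⟩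

theorem disjoint_branchSet (hab : a ≠ b) : Disjoint (M.branchSet a) (M.branchSet b) := by
  rw [Set.disjoint_left]
  intro z hza hzb
  rcases eq_branch_or_mem_route_of_mem_branchSet hza with rfl | ⟨hz, c, hac, hzc⟩ <;>
    rcases eq_branch_or_mem_route_of_mem_branchSet hzb with hz' | ⟨hz', d, hbd, hzd⟩
  · exact hab (M.branch.injective hz')
  · exact hz' a rfl
  · exact hz b hz'
  · suffices hne : s(a, c) ≠ s(b, d) by
      obtain ⟨k, hk⟩ := M.exists_branch_eq hne hzc hzd
      exact hz k hk.symm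
    rw [Ne, Sym2.eq_iff]
    rintro (⟨rfl, -⟩ | ⟨rfl, rfl⟩)
    · exact hab rfl
    · exact lt_asymm hac hbd

theorem connected_branchSet (M : SubdivisionModel H G) (a : W) :
    (G.induce (M.branchSet a)).Connected := by
  refine induce_connected_of_root (Set.mem_insert _ _) ?_
  rintro y (rfl | ⟨b, hab, hy⟩)
  · exact .refl (Set.mem_insert _ _)
  · exact hy.setOf_reachableIn.mono fun z hz => .inr ⟨b, hab, hz⟩

theorem exists_adj_branchSet (M : SubdivisionModel H G) (hab : a < b) (h : H.Adj a b) :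
    ∃ x ∈ M.branchSet a, ∃ y ∈ M.branchSet b, G.Adj x y := by
  obtain ⟨z, hz, hzb⟩ := (M.reachableIn h).exists_adj_right (M.branch.injective.ne hab.ne)
  exact ⟨z, .inr ⟨b, hab, hz⟩, M.branch b, Set.mem_insert _ _, hzb⟩

end SubdivisionModel

theorem IsTopologicalMinor.isMinor (h : IsTopologicalMinor H G) : IsMinor H G := by
  classical
  obtain ⟨M⟩ := isTopologicalMinor_iff_nonempty_subdivisionModel.1 h
  let : LinearOrder W := linearOrderOfSTO WellOrderingRel
  refine ⟨M.branchSet, M.connected_branchSet, fun a b => M.disjoint_branchSet, fun a b hab => ?_⟩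
  rcases hab.ne.lt_or_gt with hlt | hlt
  · exact M.exists_adj_branchSet hlt hab
  · obtain ⟨x, hx, y, hy, hxy⟩ := M.exists_adj_branchSet hlt hab.symm
    exact ⟨y, hy, x, hx, hxy.symm⟩

end Minor

/-! ### Suppressing a vertex -/

/-- Delete the edges at `a` and add the edge `uv`. When `u` and `v` are neighbours of `a`, this
deletes the other edges at `a` and suppresses `a`, which stays as an isolated vertex. -/
def suppress {V : Type*} (G : SimpleGraph V) (a u v : V) : SimpleGraph V :=
  G.deleteIncidenceSet a ⊔ SimpleGraph.edge u v

section Suppress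

variable {W V : Type*} {H : SimpleGraph W} {G : SimpleGraph V} {a u v x y : V}

theorem suppress_adj : (suppress G a u v).Adj x y ↔
    (G.Adj x y ∧ x ≠ a ∧ y ≠ a) ∨ (x = u ∧ y = v ∨ x = v ∧ y = u) ∧ x ≠ y := by
  rw [suppress, SimpleGraph.sup_adj, SimpleGraph.deleteIncidenceSet_adj, SimpleGraph.edge_adj]

theorem not_suppress_adj_left (hu : G.Adj a u) (hv : G.Adj a v) : ¬(suppress G a u v).Adj a y := by
  rw [suppress_adj]
  rintro (h | ⟨⟨h, -⟩ | ⟨h, -⟩, -⟩)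
  · exact h.2.1 rfl
  · exact hu.ne h
  · exact hv.ne h

theorem ReachableIn.eq_of_suppress {T : Set V} (hu : G.Adj a u) (hv : G.Adj a v)
    (h : ReachableIn (suppress G a u v) T a y) : y = a :=
  h.induction (P := (· = a)) rfl fun _ _ hcd _ _ hc =>
    absurd (hc ▸ hcd) (not_suppress_adj_left hu hv)

theorem ReachableIn.of_suppress (hu : G.Adj a u) (hv : G.Adj a v) {T T' : Set V}
    (h : ReachableIn (suppress G a u v) T x y) (hx : x ≠ a) (hT : T \ {a} ⊆ T')
    (ha : u ∈ T → v ∈ T → a ∈ T') : ReachableIn G T' x y := by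
  refine h.map (f := id) (hT ⟨h.left_mem, hx⟩) fun c d hcd hc hd => ?_
  have hc' : c ∈ T' := hT ⟨hc, fun hca => not_suppress_adj_left hu hv (hca ▸ hcd)⟩
  have hd' : d ∈ T' := hT ⟨hd, fun hda => not_suppress_adj_left hu hv (hda ▸ hcd.symm)⟩
  rcases suppress_adj.1 hcd with hG | ⟨⟨rfl, rfl⟩ | ⟨rfl, rfl⟩, -⟩
  · exact .of_adj hG.1 hc' hd'
  · exact .trans (.of_adj hu.symm hc' (ha hc hd)) (.of_adj hv (ha hc hd) hd')
  · exact .trans (.of_adj hv.symm hc' (ha hd hc)) (.of_adj hu (ha hd hc) hd')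

theorem IsTopologicalMinor.of_suppress (hH : ∀ c, ∃ d, H.Adj c d) (huv : u ≠ v) (hu : G.Adj a u)
    (hv : G.Adj a v) (h : IsTopologicalMinor H (suppress G a u v)) : IsTopologicalMinor H G := by
  rw [isTopologicalMinor_iff_nonempty_subdivisionModel] at h ⊢
  obtain ⟨M⟩ := h
  have hbranch (c : W) : M.branch c ≠ a := by
    intro hc
    obtain ⟨d, hcd⟩ := hH c
    have hd := (hc ▸ M.reachableIn hcd).eq_of_suppress hu hv
    exact hcd.ne (M.branch.injective (hc.trans hd.symm))
  refine ⟨⟨M.branch, fun e => M.route e \ {a} ∪ {z | z = a ∧ u ∈ M.route e ∧ v ∈ M.route e},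
    ?_, ?_, fun {b c} hbc => (M.reachableIn hbc).of_suppress hu hv (hbranch b)
      Set.subset_union_left fun hu' hv' => .inr ⟨rfl, hu', hv'⟩⟩⟩
  · rintro c e (hc | ⟨hc, -⟩)
    · exact M.mem_of_branch_mem_route hc.1
    · exact absurd hc (hbranch c)
  · rintro e e' x hne (⟨hx, hxa⟩ | ⟨hxa, hue, hve⟩) (⟨hx', hxa'⟩ | ⟨hxa', hue', hve'⟩)
    · exact M.exists_branch_eq hne hx hx'
    · exact absurd hxa' hxa
    · exact absurd hxa hxa'
    · obtain ⟨c, hc⟩ := M.exists_branch_eq hne hue hue'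
      obtain ⟨d, hd⟩ := M.exists_branch_eq hne hve hve'
      have hcd : c ≠ d := fun h => huv (hc.symm.trans (h ▸ hd))
      have heq (e : Sym2 W) (hu : u ∈ M.route e) (hv : v ∈ M.route e) : e = s(c, d) :=
        (Sym2.mem_and_mem_iff hcd).1
          ⟨M.mem_of_branch_mem_route (by rwa [hc]), M.mem_of_branch_mem_route (by rwa [hd])⟩
      exact absurd ((heq e hue hve).trans (heq e' hue' hve').symm) hne

theorem IsMinor.of_suppress (hH : ∀ c, ∃ d, H.Adj c d) (hu : G.Adj a u) (hv : G.Adj a v)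
    (h : IsMinor H (suppress G a u v)) : IsMinor H G := by
  obtain ⟨B, hconn, hdisj, hadj⟩ := h
  simp only [induce_connected_iff] at hconn
  have hB (c : W) : a ∉ B c := by
    intro hac
    obtain ⟨d, hcd⟩ := hH c
    obtain ⟨x, hx, y, -, hxy⟩ := hadj c d hcd
    have hxa : x = a := ((hconn c).2 a hac x hx).eq_of_suppress hu hv
    exact not_suppress_adj_left hu hv (hxa ▸ hxy)
  refine ⟨fun c => B c ∪ {z | z = a ∧ u ∈ B c}, fun c => ?_, fun c d hcd => ?_, fun c d hcd => ?_⟩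
  · obtain ⟨⟨x, hx⟩, hreach⟩ := hconn c
    have hreach' : ∀ y ∈ B c, ReachableIn G (B c ∪ {z | z = a ∧ u ∈ B c}) x y := fun y hy =>
      (hreach x hx y hy).of_suppress hu hv (fun h => hB c (h ▸ hx))
        (Set.sdiff_subset.trans Set.subset_union_left) fun hu' _ => .inr ⟨rfl, hu'⟩
    refine induce_connected_of_root (x := x) (.inl hx) ?_
    rintro y (hy | ⟨rfl, hy⟩)
    · exact hreach' y hy
    · exact (hreach' u hy).trans (.of_adj hu.symm (.inl hy) (.inr ⟨rfl, hy⟩))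
  · rw [Set.disjoint_left]
    rintro z (hz | ⟨hza, hz⟩) (hz' | ⟨hza', hz'⟩)
    · exact (hdisj c d hcd).notMem_of_mem_left hz hz'
    · exact hB c (hza' ▸ hz)
    · exact hB d (hza ▸ hz')
    · exact (hdisj c d hcd).notMem_of_mem_left hz hz'
  · obtain ⟨x, hx, y, hy, hxy⟩ := hadj c d hcd
    rcases suppress_adj.1 hxy with hG | ⟨⟨rfl, rfl⟩ | ⟨rfl, rfl⟩, -⟩
    · exact ⟨x, .inl hx, y, .inl hy, hG.1⟩
    · exact ⟨a, .inr ⟨rfl, hx⟩, y, .inl hy, hv⟩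
    · exact ⟨x, .inl hx, a, .inr ⟨rfl, hy⟩, hv.symm⟩

end Suppress

/-! ### Counting adjacent pairs -/

/-- The neighbours of `v` in the finite set `S`. -/
noncomputable def nbrsIn {V : Type*} (G : SimpleGraph V) (S : Finset V) (v : V) : Finset V :=
  open Classical in {w ∈ S | G.Adj v w}

/-- The number of pairs of adjacent vertices in `S ×ˢ T`; for `S = T` every edge counts twice. -/
noncomputable def adjPairs {V : Type*} (G : SimpleGraph V) (S T : Finset V) : ℕ :=
  ∑ v ∈ S, (nbrsIn G T v).card

section Counting

variable {V : Type*} {G G' : SimpleGraph V} {S S' T : Finset V} {u v w : V}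

@[simp]
theorem mem_nbrsIn : w ∈ nbrsIn G S v ↔ w ∈ S ∧ G.Adj v w := by
  simp [nbrsIn]

theorem nbrsIn_subset : nbrsIn G S v ⊆ S :=
  fun _ hw => (mem_nbrsIn.1 hw).1

theorem card_nbrsIn_union [DecidableEq V] (h : Disjoint S T) (v : V) :
    (nbrsIn G (S ∪ T) v).card = (nbrsIn G S v).card + (nbrsIn G T v).card := by
  rw [← Finset.card_union_of_disjoint (h.mono nbrsIn_subset nbrsIn_subset)]
  congr 1
  ext w
  simp only [mem_nbrsIn, Finset.mem_union, or_and_right]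

theorem nbrsIn_erase [DecidableEq V] (S : Finset V) (v : V) :
    nbrsIn G (S.erase v) v = nbrsIn G S v := by
  ext w
  simp only [mem_nbrsIn, Finset.mem_erase]
  exact ⟨fun h => ⟨h.1.2, h.2⟩, fun h => ⟨⟨h.2.ne', h.1⟩, h.2⟩⟩

theorem adjPairs_comm (S T : Finset V) : adjPairs G S T = adjPairs G T S := by
  classical
  simpa only [Finset.bipartiteAbove, Finset.bipartiteBelow, adjPairs, nbrsIn, G.adj_comm]
    using Finset.sum_card_bipartiteAbove_eq_sum_card_bipartiteBelow G.Adj (s := S) (t := T)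

theorem adjPairs_union_left [DecidableEq V] (h : Disjoint S S') (T : Finset V) :
    adjPairs G (S ∪ S') T = adjPairs G S T + adjPairs G S' T :=
  Finset.sum_union h

theorem adjPairs_union_self [DecidableEq V] (h : Disjoint S T) :
    adjPairs G (S ∪ T) (S ∪ T) = adjPairs G S S + 2 * adjPairs G S T + adjPairs G T T := by
  rw [adjPairs_union_left h, adjPairs_comm S, adjPairs_comm T, adjPairs_union_left h,
    adjPairs_union_left h, adjPairs_comm T S]
  ring

theorem adjPairs_singleton_left : adjPairs G {v} T = (nbrsIn G T v).card := by
  simp only [adjPairs, Finset.sum_singleton]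

theorem adjPairs_singleton_self : adjPairs G {v} {v} = 0 := by
  simp [adjPairs_singleton_left, Finset.eq_empty_iff_forall_notMem]

theorem adjPairs_erase_add [DecidableEq V] (hv : v ∈ S) :
    adjPairs G (S.erase v) (S.erase v) + 2 * (nbrsIn G S v).card = adjPairs G S S := by
  have h := adjPairs_union_self (G := G) (S := {v}) (T := S.erase v) (by simp)
  rw [← Finset.insert_eq, Finset.insert_erase hv, adjPairs_singleton_self,
    adjPairs_singleton_left, nbrsIn_erase] at h
  omega

theorem adjPairs_le_card_mul_card (S T : Finset V) : adjPairs G S T ≤ S.card * T.card := by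
  rw [← smul_eq_mul]
  exact Finset.sum_le_card_nsmul _ _ _ fun v _ => Finset.card_le_card nbrsIn_subset

theorem card_mul_le_adjPairs {n : ℕ} (h : ∀ v ∈ S, n ≤ (nbrsIn G T v).card) :
    S.card * n ≤ adjPairs G S T := by
  rw [← smul_eq_mul]
  exact Finset.card_nsmul_le_sum _ _ _ h

end Counting

/-! ### Mader's theorem: topological minors of dense graphs -/

/-- The vertices of `Z` outside `U` that have a neighbour in `U`. -/
noncomputable def boundary {V : Type*} (G : SimpleGraph V) (Z U : Finset V) : Finset V :=
  open Classical in {z ∈ Z \ U | ∃ u ∈ U, G.Adj u z}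

/-- `U` is a connected set of vertices whose contraction to a single vertex turns `G[Z]` into a
graph with at least `D` times as many edges as vertices. -/
structure IsDenseContraction {V : Type*} [DecidableEq V] (D : ℕ) (G : SimpleGraph V)
    (Z U : Finset V) : Prop where
  subset : U ⊆ Z
  connected : (G.induce (U : Set V)).Connected
  le_adjPairs :
    2 * D * ((Z \ U).card + 1) ≤ adjPairs G (Z \ U) (Z \ U) + 2 * (boundary G Z U).card

section Mader

variable {W V : Type*} {G : SimpleGraph V} {D : ℕ} {Z U : Finset V} {v z : V}

theorem mem_boundary : z ∈ boundary G Z U ↔ (z ∈ Z ∧ z ∉ U) ∧ ∃ u ∈ U, G.Adj u z := by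
  classical
  simp [boundary]

theorem boundary_subset : boundary G Z U ⊆ Z :=
  fun _ hz => (mem_boundary.1 hz).1.1

theorem disjoint_boundary : Disjoint U (boundary G Z U) :=
  Finset.disjoint_right.2 fun _ hz => (mem_boundary.1 hz).1.2

theorem boundary_singleton (Z : Finset V) (v : V) : boundary G Z {v} = nbrsIn G Z v := by
  ext z
  simp only [mem_boundary, Finset.mem_singleton, exists_eq_left, mem_nbrsIn]
  exact ⟨fun h => ⟨h.1.1, h.2⟩, fun h => ⟨⟨h.1, h.2.ne'⟩, h.2⟩⟩

theorem card_boundary_add_le [DecidableEq V] (hv : v ∈ boundary G Z U) :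
    (boundary G Z U).card + (nbrsIn G (Z \ U) v).card ≤
      (boundary G Z (insert v U)).card + (nbrsIn G (boundary G Z U) v).card + 1 := by
  have hsub : (boundary G Z U).erase v ∪ (nbrsIn G (Z \ U) v \ nbrsIn G (boundary G Z U) v) ⊆
      boundary G Z (insert v U) := by
    intro z hz
    simp only [Finset.mem_union, Finset.mem_erase, mem_boundary, Finset.mem_sdiff, mem_nbrsIn,
      Finset.mem_insert] at hz ⊢
    rcases hz with ⟨hzv, ⟨hzZ, hzU⟩, u, hu, huz⟩ | ⟨⟨⟨hzZ, hzU⟩, hvz⟩, -⟩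
    · exact ⟨⟨hzZ, not_or.2 ⟨hzv, hzU⟩⟩, u, .inr hu, huz⟩
    · exact ⟨⟨hzZ, not_or.2 ⟨hvz.ne', hzU⟩⟩, v, .inl rfl, hvz⟩
  have hdisj : Disjoint ((boundary G Z U).erase v)
      (nbrsIn G (Z \ U) v \ nbrsIn G (boundary G Z U) v) := by
    rw [Finset.disjoint_left]
    intro z hz hz'
    simp only [Finset.mem_erase, Finset.mem_sdiff, mem_nbrsIn] at hz hz'
    exact hz'.2 ⟨hz.2, hz'.1.2⟩
  have hcard := Finset.card_le_card hsub
  rw [Finset.card_union_of_disjoint hdisj] at hcard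
  have herase := Finset.card_erase_add_one hv
  have hsdiff := Finset.le_card_sdiff (nbrsIn G (boundary G Z U) v) (nbrsIn G (Z \ U) v)
  omega

theorem IsDenseContraction.singleton [DecidableEq V] (hv : v ∈ Z)
    (hD : 2 * D * Z.card ≤ adjPairs G Z Z) : IsDenseContraction D G Z {v} where
  subset := Finset.singleton_subset_iff.2 hv
  connected := by
    rw [Finset.coe_singleton]
    exact .of_subsingleton
  le_adjPairs := by
    rwa [boundary_singleton, Finset.sdiff_singleton_eq_erase, Finset.card_erase_add_one hv,
      adjPairs_erase_add hv]

theorem IsDenseContraction.insert [DecidableEq V] (hU : IsDenseContraction D G Z U)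
    (hv : v ∈ boundary G Z U) (hlt : (nbrsIn G (boundary G Z U) v).card < D) :
    IsDenseContraction D G Z (insert v U) := by
  obtain ⟨⟨hvZ, hvU⟩, u, hu, huv⟩ := mem_boundary.1 hv
  have hvS : v ∈ Z \ U := Finset.mem_sdiff.2 ⟨hvZ, hvU⟩
  refine ⟨Finset.insert_subset hvZ hU.subset, ?_, ?_⟩
  · rw [Finset.coe_insert, Set.insert_eq]
    exact SimpleGraph.connected_induce_union .of_subsingleton hU.connected.preconnected rfl hu
      huv.symm
  · have hle := hU.le_adjPairs
    rw [← adjPairs_erase_add hvS, ← Finset.card_erase_add_one hvS, mul_add_one] at hle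
    have hcard := card_boundary_add_le hv
    rw [Finset.sdiff_insert]
    omega

theorem exists_isDenseContraction_le_card_nbrsIn [DecidableEq V] (hZ : Z.Nonempty)
    (hD : 2 * D * Z.card ≤ adjPairs G Z Z) : ∃ U, IsDenseContraction D G Z U ∧
      ∀ v ∈ boundary G Z U, D ≤ (nbrsIn G (boundary G Z U) v).card := by
  obtain ⟨v₀, hv₀⟩ := hZ
  obtain ⟨U, hU⟩ := Set.Finite.exists_maximal (s := {U | IsDenseContraction D G Z U})
    (Z.powerset.finite_toSet.subset fun U hU => Finset.mem_coe.2 (Finset.mem_powerset.2 hU.subset))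
    ⟨{v₀}, .singleton hv₀ hD⟩
  refine ⟨U, hU.prop, fun v hv => ?_⟩
  by_contra! hlt
  exact (mem_boundary.1 hv).1.2
    (hU.le_of_ge (hU.prop.insert hv hlt) (Finset.subset_insert v U) (Finset.mem_insert_self v U))

theorem IsDenseContraction.sdiff_of_boundary_eq_empty [DecidableEq V]
    (hU : IsDenseContraction D G Z U) (hD : 0 < D) (hbd : boundary G Z U = ∅) :
    (Z \ U).Nonempty ∧ 2 * D * (Z \ U).card ≤ adjPairs G (Z \ U) (Z \ U) := by
  have hle := hU.le_adjPairs
  rw [hbd, Finset.card_empty, mul_zero, add_zero, mul_add_one] at hle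
  refine ⟨Finset.nonempty_iff_ne_empty.2 fun hempty => ?_, by omega⟩
  rw [hempty, adjPairs, Finset.sum_empty] at hle
  omega

namespace SubdivisionModel

variable {H : SimpleGraph W}

/-- The vertices of a subdivision. -/
def support (M : SubdivisionModel H G) : Set V :=
  Set.range M.branch ∪ ⋃ e, M.route e

theorem route_subset_support (M : SubdivisionModel H G) (e : Sym2 W) : M.route e ⊆ M.support :=
  (Set.subset_iUnion M.route e).trans Set.subset_union_right

theorem branch_mem_support (M : SubdivisionModel H G) (c : W) : M.branch c ∈ M.support :=
  .inl ⟨c, rfl⟩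

/-- The subdivision of `H` together with the edge `e₀`, where `e₀` is routed through `R`. -/
noncomputable def addRoute (M : SubdivisionModel H G) (e₀ : Sym2 W) (R : Set V)
    (hbranch : ∀ {c}, M.branch c ∈ R → c ∈ e₀)
    (hmeet : ∀ {e x}, x ∈ R → x ∈ M.route e → ∃ c, M.branch c = x)
    (hR : ∀ {a b}, s(a, b) = e₀ → ReachableIn G R (M.branch a) (M.branch b)) :
    SubdivisionModel (H ⊔ .fromEdgeSet {e₀}) G where
  branch := M.branch
  route := open Classical in Function.update M.route e₀ R
  mem_of_branch_mem_route {c e} hc := by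
    rcases eq_or_ne e e₀ with rfl | he
    · exact hbranch (by simpa using hc)
    · exact M.mem_of_branch_mem_route (by simpa [he] using hc)
  exists_branch_eq {e e' x} hne hx hx' := by
    rcases eq_or_ne e e₀ with rfl | he
    · exact hmeet (by simpa using hx) (by simpa [hne.symm] using hx')
    rcases eq_or_ne e' e₀ with rfl | he'
    · exact hmeet (by simpa using hx') (by simpa [hne] using hx)
    exact M.exists_branch_eq hne (by simpa [he] using hx) (by simpa [he'] using hx')
  reachableIn {a b} hab := by
    rcases eq_or_ne s(a, b) e₀ with he | he
    · simpa [he] using hR he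
    · simpa [he] using M.reachableIn (hab.resolve_right fun h => he h.1)

theorem support_addRoute_subset {M : SubdivisionModel H G} {e₀ : Sym2 W} {R : Set V} {hbranch}
    {hmeet} {hR} : (M.addRoute e₀ R hbranch hmeet hR).support ⊆ R ∪ M.support := by
  refine Set.union_subset (Set.subset_union_left.trans Set.subset_union_right)
    (Set.iUnion_subset fun e => ?_)
  rcases eq_or_ne e e₀ with rfl | he
  · simp [addRoute]
  · simpa [addRoute, he] using (M.route_subset_support e).trans Set.subset_union_right

theorem exists_sup_fromEdgeSet (M : SubdivisionModel H G) (e₀ : Sym2 W) {U : Set V}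
    (hU : (G.induce U).Connected) (hdisj : Disjoint U M.support)
    (hadj : ∀ c, ∃ u ∈ U, G.Adj u (M.branch c)) :
    ∃ M' : SubdivisionModel (H ⊔ .fromEdgeSet {e₀}) G, M'.support ⊆ U ∪ M.support := by
  have hsub : (U ∪ M.branch '' {c | c ∈ e₀}) ∪ M.support ⊆ U ∪ M.support := by
    rintro x ((hx | ⟨c, -, rfl⟩) | hx)
    exacts [.inl hx, .inr (M.branch_mem_support c), .inr hx]
  refine ⟨M.addRoute e₀ (U ∪ M.branch '' {c | c ∈ e₀}) ?_ ?_ ?_,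
    support_addRoute_subset.trans hsub⟩
  · rintro c (hc | ⟨c', hc', heq⟩)
    · exact absurd (M.branch_mem_support c) (hdisj.notMem_of_mem_left hc)
    · exact M.branch.injective heq ▸ hc'
  · rintro e x (hx | ⟨c, -, hc⟩) hxe
    · exact absurd (M.route_subset_support e hxe) (hdisj.notMem_of_mem_left hx)
    · exact ⟨c, hc⟩
  · rintro a b rfl
    obtain ⟨x, hx, hxa⟩ := hadj a
    obtain ⟨y, hy, hyb⟩ := hadj b
    have hxy := ((induce_connected_iff.1 hU).2 x hx y hy).mono
      (Set.subset_union_left (t := M.branch '' {c | c ∈ s(a, b)}))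
    exact ((ReachableIn.of_adj hxa.symm (.inr ⟨a, by simp, rfl⟩) (.inl hx)).trans hxy).trans
      (.of_adj hyb (.inl hy) (.inr ⟨b, by simp, rfl⟩))

end SubdivisionModel

theorem exists_subdivisionModel_bot [Fintype W] (hW : Fintype.card W ≤ Z.card) :
    ∃ M : SubdivisionModel (⊥ : SimpleGraph W) G, M.support ⊆ Z := by
  obtain ⟨f⟩ : Nonempty (W ↪ Z) :=
    Function.Embedding.nonempty_of_card_le (by rwa [Fintype.card_coe])
  refine ⟨⟨f.trans (.subtype _), fun _ => ∅, by simp, by simp, by simp⟩, ?_⟩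
  rintro _ (⟨c, rfl⟩ | hx)
  · exact (f c).2
  · simp at hx

theorem exists_subdivisionModel_of_le_adjPairs [Fintype W] [Nonempty W] (F : Finset (Sym2 W))
    (hZ : Z.Nonempty) (hF : 2 * (2 ^ F.card * Fintype.card W) * Z.card ≤ adjPairs G Z Z) :
    ∃ M : SubdivisionModel (.fromEdgeSet (F : Set (Sym2 W))) G, M.support ⊆ Z := by
  classical
  induction F using Finset.induction generalizing Z with
  | empty =>
    have hcard : 2 * (2 ^ 0 * Fintype.card W) ≤ Z.card :=
      Nat.le_of_mul_le_mul_right (hF.trans (adjPairs_le_card_mul_card Z Z)) hZ.card_pos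
    rw [Finset.coe_empty, SimpleGraph.fromEdgeSet_empty]
    exact exists_subdivisionModel_bot (by omega)
  | insert e₀ F he₀ ih =>
    rw [Finset.card_insert_of_notMem he₀] at hF
    induction Z using Finset.strongInduction with
    | H Z ihZ =>
    obtain ⟨U, hU, hdeg⟩ := exists_isDenseContraction_le_card_nbrsIn hZ hF
    have hUne : U.Nonempty := Set.nonempty_coe_sort.1 hU.connected.nonempty
    rcases (boundary G Z U).eq_empty_or_nonempty with hN | hN
    · have hpos : 0 < 2 ^ (F.card + 1) * Fintype.card W :=
        Nat.mul_pos (by positivity) Fintype.card_pos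
      obtain ⟨hne, hle⟩ := hU.sdiff_of_boundary_eq_empty hpos hN
      obtain ⟨M, hM⟩ := ihZ (Z \ U) (Finset.sdiff_ssubset hU.subset hUne) hne hle
      exact ⟨M, hM.trans (Finset.coe_subset.2 Finset.sdiff_subset)⟩
    · obtain ⟨M, hM⟩ := ih hN <| by
        convert card_mul_le_adjPairs hdeg using 1
        ring
      obtain ⟨M', hM'⟩ := M.exists_sup_fromEdgeSet e₀ hU.connected
        ((Finset.disjoint_coe.2 disjoint_boundary).mono_right hM)
        fun c => (mem_boundary.1 (hM (M.branch_mem_support c))).2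
      rw [Finset.coe_insert, Set.insert_eq, SimpleGraph.fromEdgeSet_union, sup_comm]
      exact ⟨M', hM'.trans (Set.union_subset (Finset.coe_subset.2 hU.subset)
        (hM.trans (Finset.coe_subset.2 boundary_subset)))⟩

theorem exists_adjPairs_lt_of_not_isTopologicalMinor [Finite W] [Nonempty W] (H : SimpleGraph W) :
    ∃ D : ℕ, ∀ (V : Type*) (G : SimpleGraph V) (Z : Finset V), Z.Nonempty →
      ¬IsTopologicalMinor H G → adjPairs G Z Z < 2 * D * Z.card := by
  classical
  have := Fintype.ofFinite W
  refine ⟨2 ^ H.edgeFinset.card * Fintype.card W, fun V G Z hZ hG => ?_⟩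
  by_contra! hle
  obtain ⟨M, -⟩ := exists_subdivisionModel_of_le_adjPairs H.edgeFinset hZ hle
  rw [SimpleGraph.coe_edgeFinset, SimpleGraph.fromEdgeSet_edgeSet] at M
  exact hG (isTopologicalMinor_iff_nonempty_subdivisionModel.2 ⟨M⟩)

end Mader

/-! ### Classes between the two minor-free classes -/

/-- `C` lies between the `K_{s+1}`-minor-free graphs and the graphs with no `K_{s+1}` topological
minor, and is closed under subgraphs and under suppressing a vertex. The theorem is proved for all
such classes at once. -/
structure IsIntermediateClass (s : ℕ) (C : GraphClass.{u}) : Prop where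
  map {V U : Type u} {G : SimpleGraph V} {G' : SimpleGraph U} (g : V ↪ U)
    (hg : ∀ x y, G.Adj x y → G'.Adj (g x) (g y)) : C U G' → C V G
  suppress {V : Type u} {G : SimpleGraph V} {a u v : V} (huv : u ≠ v) (hu : G.Adj a u)
    (hv : G.Adj a v) : C V G → C V (suppress G a u v)
  of_not_isMinor {V : Type u} {G : SimpleGraph V} :
    ¬IsMinor (⊤ : SimpleGraph (Fin (s + 1))) G → C V G
  not_isTopologicalMinor {V : Type u} {G : SimpleGraph V} :
    C V G → ¬IsTopologicalMinor (⊤ : SimpleGraph (Fin (s + 1))) G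

section Classes

variable {s : ℕ} {C : GraphClass.{u}}

theorem IsIntermediateClass.mono (hC : IsIntermediateClass s C) {V : Type u} {G G' : SimpleGraph V}
    (h : G ≤ G') : C V G' → C V G :=
  hC.map (.refl V) fun _ _ hxy => h hxy

theorem exists_top_adj_fin_succ (hs : 1 ≤ s) (c : Fin (s + 1)) :
    ∃ d, (⊤ : SimpleGraph (Fin (s + 1))).Adj c d := by
  have : Nontrivial (Fin (s + 1)) := Fin.nontrivial_iff_two_le.2 (by omega)
  exact (exists_ne c).imp fun d hd => hd.symm

theorem isIntermediateClass_minorFree (hs : 1 ≤ s) :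
    IsIntermediateClass s (minorFree.{u} (⊤ : SimpleGraph (Fin (s + 1)))) where
  map g hg hG h := hG (h.map g hg)
  suppress _ hu hv hG h := hG (.of_suppress (exists_top_adj_fin_succ hs) hu hv h)
  of_not_isMinor h := h
  not_isTopologicalMinor hG h := hG h.isMinor

theorem isIntermediateClass_topologicalMinorFree (hs : 1 ≤ s) :
    IsIntermediateClass s (topologicalMinorFree.{u} (⊤ : SimpleGraph (Fin (s + 1)))) where
  map g hg hG h := hG (h.map g hg)
  suppress huv hu hv hG h := hG (.of_suppress (exists_top_adj_fin_succ hs) huv hu hv h)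
  of_not_isMinor hG h := hG h.isMinor
  not_isTopologicalMinor h := h

end Classes

/-! ### Densities -/

section Density

variable {s : ℕ} {C : GraphClass.{u}} {δ : ℝ}

theorem adjPairs_univ {V : Type*} [Fintype V] (G : SimpleGraph V) :
    adjPairs G Finset.univ Finset.univ = 2 * G.edgeSet.ncard := by
  classical
  rw [← SimpleGraph.coe_edgeFinset, Set.ncard_coe_finset, ← G.sum_degrees_eq_twice_card_edges]
  refine Finset.sum_congr rfl fun v _ => ?_
  rw [← SimpleGraph.card_neighborFinset_eq_degree]
  congr 1
  ext w
  simp only [mem_nbrsIn, Finset.mem_univ, true_and, SimpleGraph.mem_neighborFinset]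

theorem adjPairs_induce {V : Type*} (G : SimpleGraph V) (Z : Finset V) :
    adjPairs (G.induce (Z : Set V)) Finset.univ Finset.univ = adjPairs G Z Z := by
  rw [adjPairs, adjPairs, ← Finset.sum_coe_sort Z]
  refine Finset.sum_congr rfl fun v _ => ?_
  rw [← Finset.card_map (.subtype (· ∈ Z))]
  congr 1
  ext w
  simp [and_comm]

theorem IsIntermediateClass.bddAbove_densities (hC : IsIntermediateClass s C) :
    BddAbove (densities C) := by
  obtain ⟨D, hD⟩ := exists_adjPairs_lt_of_not_isTopologicalMinor.{0, u}
    (⊤ : SimpleGraph (Fin (s + 1)))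
  refine ⟨D, ?_⟩
  rintro x ⟨V, hV, hV', G, hG, rfl⟩
  have := Fintype.ofFinite V
  have hlt := hD V G Finset.univ Finset.univ_nonempty (hC.not_isTopologicalMinor hG)
  rw [adjPairs_univ, mul_assoc, mul_lt_mul_iff_right₀ two_pos, Finset.card_univ,
    ← Nat.card_eq_fintype_card] at hlt
  rw [div_le_iff₀ (by exact_mod_cast Nat.card_pos)]
  exact_mod_cast hlt.le

theorem IsIntermediateClass.adjPairs_le (hC : IsIntermediateClass s C)
    (hδ : δ ∈ upperBounds (densities C)) {V : Type u} {G : SimpleGraph V} (hG : C V G)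
    (Z : Finset V) : (adjPairs G Z Z : ℝ) ≤ 2 * (δ * Z.card) := by
  rcases Z.eq_empty_or_nonempty with rfl | hZ
  · simp [adjPairs]
  · have : Nonempty (Z : Set V) := hZ.to_subtype
    have hle := hδ ⟨(Z : Set V), inferInstance, this, G.induce (Z : Set V),
      hC.map (.subtype _) (fun _ _ h => h) hG, rfl⟩
    rw [div_le_iff₀ (by exact_mod_cast Nat.card_pos), Nat.card_coe_set_eq,
      Set.ncard_coe_finset] at hle
    rw [← adjPairs_induce, adjPairs_univ, Nat.cast_mul, Nat.cast_two]
    gcongr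

theorem not_isMinor_top_of_isVertexCover {W V : Type*} {G : SimpleGraph V} {T : Set V}
    (hT : G.IsVertexCover T) (hcard : T.encard + 1 < ENat.card W) :
    ¬IsMinor (⊤ : SimpleGraph W) G := by
  rintro ⟨B, hconn, hdisj, hadj⟩
  have hrep (c : W) : ∃ x ∈ B c, ¬Disjoint (B c) T → x ∈ T := by
    by_cases h : Disjoint (B c) T
    · exact (induce_connected_iff.1 (hconn c)).1.imp fun x hx => ⟨hx, absurd h⟩
    · obtain ⟨x, hx, hxT⟩ := Set.not_disjoint_iff.1 h
      exact ⟨x, hx, fun _ => hxT⟩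
  choose g hg hgT using hrep
  have hmeet : {c | Disjoint (B c) T}ᶜ.encard ≤ T.encard := by
    refine Set.encard_le_encard_of_injOn (f := g) (fun c hc => hgT c hc) fun c _ c' _ hcc' => ?_
    by_contra hne
    exact (hdisj c c' hne).notMem_of_mem_left (hg c) (hcc' ▸ hg c')
  have hmiss : {c | Disjoint (B c) T}.encard ≤ 1 := by
    refine Set.encard_le_one_iff.2 fun c c' hc hc' => ?_
    by_contra hne
    obtain ⟨x, hx, y, hy, hxy⟩ := hadj c c' hne
    exact (hT hxy).elim (hc.notMem_of_mem_left hx) (hc'.notMem_of_mem_left hy)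
  refine hcard.not_ge ?_
  rw [← Set.encard_univ, ← Set.encard_add_encard_compl {c | Disjoint (B c) T}, add_comm]
  gcongr

theorem not_isMinor_completeBipartiteGraph {W V U : Type*} (hcard : ENat.card V + 1 < ENat.card W) :
    ¬IsMinor (⊤ : SimpleGraph W) (completeBipartiteGraph V U) := by
  refine not_isMinor_top_of_isVertexCover (T := Set.range Sum.inl) ?_ ?_
  · rintro (x | x) (y | y) hxy <;> simp_all
  · rwa [← Set.image_univ, Sum.inl_injective.encard_image, Set.encard_univ]

theorem IsIntermediateClass.le_of_mem_upperBounds_densities (hC : IsIntermediateClass s C)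
    (hs : 1 ≤ s) (hδ : δ ∈ upperBounds (densities C)) : (s : ℝ) - 1 ≤ δ := by
  obtain ⟨t, rfl⟩ := Nat.exists_eq_add_of_le' hs
  have hbipartite (n : ℕ) : (t : ℝ) * (n + 1) ≤ δ * (t + (n + 1)) := by
    have hle := hδ ⟨ULift.{u} (Fin t) ⊕ ULift.{u} (Fin (n + 1)), inferInstance, inferInstance, _,
      hC.of_not_isMinor (not_isMinor_completeBipartiteGraph (by simp; norm_cast; omega)), rfl⟩
    rw [div_le_iff₀ (by exact_mod_cast Nat.card_pos), Set.ncard,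
      SimpleGraph.encard_edgeSet_completeBipartiteGraph] at hle
    have hcard : ((n : ℕ∞) + 1).toNat = n + 1 := rfl
    simpa [hcard] using hle
  by_contra! hlt
  push_cast at hlt
  have hpos : 0 < (t : ℝ) - δ := by linarith
  obtain ⟨n, hn⟩ := exists_nat_gt (δ * t / (t - δ))
  rw [div_lt_iff₀ hpos] at hn
  nlinarith [hbipartite n]

end Density

/-! ### The lower bound -/

/-- `G` together with a new vertex `none` that is adjacent to all vertices of `G`. -/
def cone {V : Type*} (G : SimpleGraph V) : SimpleGraph (Option V) where
  Adj x y := x ≠ y ∧ ∀ x' ∈ x, ∀ y' ∈ y, G.Adj x' y'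
  symm := ⟨fun _ _ h => ⟨h.1.symm, fun x' hx y' hy => (h.2 y' hy x' hx).symm⟩⟩
  loopless := ⟨fun _ h => h.1 rfl⟩

section LowerBound

variable {W V U ι α : Type*} {H : SimpleGraph W} {G : SimpleGraph V} {G' : SimpleGraph U} {d n : ℕ}

@[simp]
theorem cone_adj_some_some {x y : V} : (cone G).Adj (some x) (some y) ↔ G.Adj x y := by
  simpa [cone] using fun h : G.Adj x y => h.ne

@[simp]
theorem cone_adj_none_some {x : V} : (cone G).Adj none (some x) := by
  simp [cone]

theorem ReachableIn.of_cone {S : Set (Option V)} {x y : V} (hS : none ∉ S)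
    (h : ReachableIn (cone G) S (some x) (some y)) : ReachableIn G (some ⁻¹' S) x y := by
  refine h.map (f := (Option.getD · x)) h.left_mem fun c d hcd hc hd => ?_
  obtain ⟨c, rfl⟩ := Option.ne_none_iff_exists'.1 fun hnone => hS (hnone ▸ hc)
  obtain ⟨d, rfl⟩ := Option.ne_none_iff_exists'.1 fun hnone => hS (hnone ▸ hd)
  exact .of_adj (cone_adj_some_some.1 hcd) hc hd

theorem IsMinor.of_cone (h : IsMinor (⊤ : SimpleGraph (Fin (n + 1))) (cone G)) :
    IsMinor (⊤ : SimpleGraph (Fin n)) G := by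
  obtain ⟨B, hconn, hdisj, hadj⟩ := h
  simp only [induce_connected_iff] at hconn
  obtain ⟨c₀, hc₀⟩ : ∃ c₀, ∀ c, c ≠ c₀ → none ∉ B c := by
    by_contra! hnone
    obtain ⟨c, -, hc⟩ := hnone 0
    obtain ⟨c', hne, hc'⟩ := hnone c
    exact (hdisj c' c hne).notMem_of_mem_left hc' hc
  have hsome {k z} (hz : z ∈ B (c₀.succAbove k)) : ∃ x, z = some x :=
    Option.ne_none_iff_exists'.1 fun hnone => hc₀ _ (c₀.succAbove_ne k) (hnone ▸ hz)
  refine ⟨fun k => some ⁻¹' B (c₀.succAbove k), fun k => ?_, fun k l hkl => ?_, fun k l hkl => ?_⟩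
  · obtain ⟨z, hz⟩ := (hconn (c₀.succAbove k)).1
    obtain ⟨x, rfl⟩ := hsome hz
    exact induce_connected_of_root hz fun y hy =>
      .of_cone (hc₀ _ (c₀.succAbove_ne k)) ((hconn _).2 _ hz _ hy)
  · exact (hdisj _ _ (Fin.succAbove_right_injective.ne hkl)).preimage _
  · obtain ⟨z, hz, w, hw, hzw⟩ := hadj _ _ (Fin.succAbove_right_injective.ne hkl)
    obtain ⟨x, rfl⟩ := hsome hz
    obtain ⟨y, rfl⟩ := hsome hw
    exact ⟨x, hz, y, hw, cone_adj_some_some.1 hzw⟩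

theorem IsMinor.of_bot_boxProd (hH : H.Preconnected)
    (h : IsMinor H ((⊥ : SimpleGraph ι) □ G)) : IsMinor H G := by
  obtain ⟨B, hconn, hdisj, hadj⟩ := h
  simp only [induce_connected_iff] at hconn
  have hstep {z w : ι × V} (hzw : ((⊥ : SimpleGraph ι) □ G).Adj z w) :
      z.1 = w.1 ∧ G.Adj z.2 w.2 := by
    simpa [SimpleGraph.boxProd_adj, and_comm] using hzw
  have hfst_branch {a z w} (hz : z ∈ B a) (hw : w ∈ B a) : z.1 = w.1 :=
    ((hconn a).2 z hz w hw).induction (P := fun w => z.1 = w.1) rfl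
      fun _ _ hbc _ _ hb => hb.trans (hstep hbc).1
  have hfst (a b : W) : ∀ z ∈ B a, ∀ w ∈ B b, z.1 = w.1 := by
    obtain ⟨p⟩ := hH a b
    induction p with
    | nil => exact fun z hz w hw => hfst_branch hz hw
    | cons hab _ ih =>
      intro z hz w hw
      obtain ⟨x, hx, y, hy, hxy⟩ := hadj _ _ hab
      exact (hfst_branch hz hx).trans ((hstep hxy).1.trans (ih y hy w hw))
  refine ⟨fun a => Prod.snd '' B a, fun a => ?_, fun a b hab => ?_, fun a b hab => ?_⟩
  · obtain ⟨z, hz⟩ := (hconn a).1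
    refine induce_connected_of_root (Set.mem_image_of_mem _ hz) (Set.forall_mem_image.2 ?_)
    exact fun w hw => ((hconn a).2 z hz w hw).map (Set.mem_image_of_mem _ hz) fun c d hcd hc hd =>
      .of_adj (hstep hcd).2 (Set.mem_image_of_mem _ hc) (Set.mem_image_of_mem _ hd)
  · rw [Set.disjoint_left]
    rintro _ ⟨z, hz, rfl⟩ ⟨w, hw, hwz⟩
    obtain rfl : w = z := Prod.ext (hfst b a w hw z hz) hwz
    exact (hdisj a b hab).notMem_of_mem_left hz hw
  · obtain ⟨x, hx, y, hy, hxy⟩ := hadj a b hab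
    exact ⟨x.2, Set.mem_image_of_mem _ hx, y.2, Set.mem_image_of_mem _ hy, (hstep hxy).2⟩

theorem HasDefect.comp {c : U → α} (h : HasDefect G' c d) (g : V ↪ U)
    (hg : ∀ x y, G.Adj x y → G'.Adj (g x) (g y)) : HasDefect G (c ∘ g) d := by
  intro v
  rw [← g.injective.encard_image]
  refine (Set.encard_le_encard ?_).trans (h (g v))
  rintro _ ⟨w, hw, rfl⟩
  exact ⟨hg _ _ hw.1, hw.2⟩

theorem HasDefect.exists_forall_ne_apex {G : SimpleGraph (Fin (d + 1) × V)}
    {c : Option (Fin (d + 1) × V) → α} (h : HasDefect (cone G) c d) :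
    ∃ i, ∀ x, c (some (i, x)) ≠ c none := by
  by_contra! hcopy
  choose x hx using hcopy
  have hinj : Function.Injective fun i => some (i, x i) :=
    fun i j hij => congrArg Prod.fst (Option.some.inj hij)
  have hle := (Set.encard_le_encard (Set.range_subset_iff.2 fun i =>
    show some (i, x i) ∈ {w | (cone G).Adj none w ∧ c w = c none} from
      ⟨cone_adj_none_some, hx i⟩)).trans (h none)
  rw [← Set.image_univ, hinj.encard_image, Set.encard_univ, ENat.card_eq_coe_fintype_card,
    Fintype.card_fin, Nat.cast_le] at hle
  omega

theorem exists_not_isMinor_le_ncard_range (d s : ℕ) :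
    ∃ (V : Type u) (_ : Finite V) (G : SimpleGraph V),
      ¬IsMinor (⊤ : SimpleGraph (Fin (s + 1))) G ∧
      ∀ (α : Type) (c : V → α), HasDefect G c d → s ≤ (Set.range c).ncard := by
  induction s with
  | zero =>
    refine ⟨PEmpty, inferInstance, ⊥, ?_, fun _ _ _ => Nat.zero_le _⟩
    rintro ⟨B, hconn, -⟩
    obtain ⟨x, -⟩ := (induce_connected_iff.1 (hconn 0)).1
    exact x.elim
  | succ s ih =>
    obtain ⟨V, hV, G, hG, hcol⟩ := ih
    refine ⟨_, inferInstance, cone ((⊥ : SimpleGraph (Fin (d + 1))) □ G),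
      fun h => hG (h.of_cone.of_bot_boxProd SimpleGraph.preconnected_top), fun α c hc => ?_⟩
    obtain ⟨i, hi⟩ := hc.exists_forall_ne_apex
    let copy : V ↪ Option (Fin (d + 1) × V) :=
      ⟨fun x => some (i, x), fun x y hxy => congrArg Prod.snd (Option.some.inj hxy)⟩
    have hcopy := hcol α _ (hc.comp copy fun x y hxy => by
      exact cone_adj_some_some.2 (SimpleGraph.boxProd_adj_right.2 hxy))
    calc s + 1 ≤ (insert (c none) (Set.range (c ∘ copy))).ncard := by
          rw [Set.ncard_insert_of_notMem (by rintro ⟨x, hx⟩; exact hi x hx) (Set.toFinite _)]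
          omega
      _ ≤ (Set.range c).ncard :=
          Set.ncard_le_ncard (Set.insert_subset (Set.mem_range_self _)
            (Set.range_comp_subset_range _ _)) (Set.toFinite _)

theorem IsChoosable.isColourable {V : Type u} {G : SimpleGraph V} {k d : ℕ}
    (h : IsChoosable G k d) : IsColourable G k d := by
  obtain ⟨c, -, hc⟩ := h (ULift.{u} (Fin k)) (fun _ => Finset.univ) fun _ => by simp
  refine ⟨fun v => (c v).down, fun v => ?_⟩
  simpa only [ULift.down_inj] using hc v

theorem IsIntermediateClass.le_of_forall_isColourable {s k : ℕ} {C : GraphClass.{u}}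
    (hC : IsIntermediateClass s C)
    (h : ∀ (V : Type u) [Finite V] (G : SimpleGraph V), C V G → IsColourable G k d) : s ≤ k := by
  obtain ⟨V, hV, G, hG, hcol⟩ := exists_not_isMinor_le_ncard_range.{u} d s
  obtain ⟨c, hc⟩ := h V G (hC.of_not_isMinor hG)
  simpa using (hcol _ c hc).trans (Set.ncard_le_ncard (Set.subset_univ (Set.range c)))

theorem IsIntermediateClass.hasDefectiveNumbers {s : ℕ} {C : GraphClass.{u}}
    (hC : IsIntermediateClass s C)
    (h : ∀ (V : Type u) [Finite V] (G : SimpleGraph V), C V G → IsChoosable G s d) :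
    HasDefectiveChromaticNumber C s ∧ HasDefectiveChoiceNumber C s :=
  ⟨⟨⟨d, fun V _ G hG => (h V G hG).isColourable⟩,
      fun _ ⟨_, hk⟩ => hC.le_of_forall_isColourable hk⟩,
    ⟨⟨d, h⟩, fun _ ⟨_, hk⟩ => hC.le_of_forall_isColourable fun V _ G hG =>
      (hk V G hG).isColourable⟩⟩

end LowerBound

/-! ### Recolouring -/

section Colouring

variable {V α : Type*} [Fintype V] {G : SimpleGraph V} {s d n : ℕ} {c : V → α} {v w : V} {γ : α}

/-- The neighbours of `v` with the colour of `v`. -/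
noncomputable def monoNbrs (G : SimpleGraph V) (c : V → α) (v : V) : Finset V :=
  open Classical in {w ∈ nbrsIn G Finset.univ v | c w = c v}

@[simp]
theorem mem_monoNbrs : w ∈ monoNbrs G c v ↔ G.Adj v w ∧ c w = c v := by
  simp [monoNbrs]

theorem monoNbrs_subset : monoNbrs G c v ⊆ nbrsIn G Finset.univ v := by
  classical exact Finset.filter_subset _ _

theorem hasDefect_iff : HasDefect G c d ↔ ∀ v, (monoNbrs G c v).card ≤ d := by
  refine forall_congr' fun v => ?_
  rw [← Nat.cast_le (α := ℕ∞), ← Set.encard_coe_eq_coe_finsetCard]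
  congr! 2
  ext w
  simp

theorem mem_monoNbrs_update_self [DecidableEq V] :
    w ∈ monoNbrs G (Function.update c v γ) v ↔ G.Adj v w ∧ c w = γ := by
  rw [mem_monoNbrs, Function.update_self]
  exact and_congr_right fun hvw => by rw [Function.update_of_ne hvw.ne']

theorem monoNbrs_update_subset [DecidableEq V] (hwv : w ≠ v) (hγ : G.Adj v w → c w ≠ γ) :
    monoNbrs G (Function.update c v γ) w ⊆ monoNbrs (G.deleteIncidenceSet v) c w := by
  intro z hz
  rw [mem_monoNbrs, Function.update_of_ne hwv] at hz
  rcases eq_or_ne z v with rfl | hzv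
  · rw [Function.update_self] at hz
    exact absurd hz.2.symm (hγ hz.1.symm)
  · rw [Function.update_of_ne hzv] at hz
    exact mem_monoNbrs.2 ⟨SimpleGraph.deleteIncidenceSet_adj.2 ⟨hz.1, hwv, hzv⟩, hz.2⟩

theorem monoNbrs_update_subset_self [DecidableEq V] (hγ : ∀ w, G.Adj v w → c w ≠ γ) (w : V) :
    monoNbrs G (Function.update c v γ) w ⊆ monoNbrs G c w := by
  rcases eq_or_ne w v with rfl | hwv
  · intro z hz
    rw [mem_monoNbrs_update_self] at hz
    exact absurd hz.2 (hγ z hz.1)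
  · refine (monoNbrs_update_subset hwv (hγ w)).trans fun z hz => ?_
    rw [mem_monoNbrs] at hz ⊢
    exact ⟨G.deleteIncidenceSet_le v hz.1, hz.2⟩

theorem exists_mem_forall_adj_ne {S : Finset α}
    (hS : (nbrsIn G Finset.univ v).card + 1 < (monoNbrs G c v).card + S.card) :
    ∃ γ ∈ S, ∀ w, G.Adj v w → c w ≠ γ := by
  classical
  have hcard := Finset.card_sdiff_add_card_eq_card (monoNbrs_subset (G := G) (c := c) (v := v))
  have himage := Finset.card_image_le (f := c) (s := nbrsIn G Finset.univ v \ monoNbrs G c v)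
  have hinsert := Finset.card_insert_le (c v) ((nbrsIn G Finset.univ v \ monoNbrs G c v).image c)
  obtain ⟨γ, hγ, hγ'⟩ : ∃ γ ∈ S,
      γ ∉ insert (c v) ((nbrsIn G Finset.univ v \ monoNbrs G c v).image c) :=
    Finset.exists_mem_notMem_of_card_lt_card (by omega)
  refine ⟨γ, hγ, ?_⟩
  rintro w hw rfl
  refine hγ' (Finset.mem_insert.2 (or_iff_not_imp_left.2 fun hcw => ?_))
  refine Finset.mem_image_of_mem c (Finset.mem_sdiff.2 ⟨?_, fun h => hcw (mem_monoNbrs.1 h).2⟩)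
  exact mem_nbrsIn.2 ⟨Finset.mem_univ w, hw⟩

/-- Minimise the number of monochromatic edges: a vertex that still has too many neighbours of its
colour has low degree, hence a colour in its list that appears on none of its neighbours. -/
theorem exists_hasDefect_of_forall_card_monoNbrs_le {L : V → Finset α} (hc : ∀ v, c v ∈ L v)
    (hhigh : ∀ v, d + (L v).card ≤ (nbrsIn G Finset.univ v).card → (monoNbrs G c v).card ≤ d) :
    ∃ c : V → α, (∀ v, c v ∈ L v) ∧ HasDefect G c d := by
  classical
  obtain ⟨c, ⟨hc, hhigh⟩, hmin⟩ := exists_minimalFor_of_wellFoundedLT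
    (fun c : V → α => (∀ v, c v ∈ L v) ∧
      ∀ v, d + (L v).card ≤ (nbrsIn G Finset.univ v).card → (monoNbrs G c v).card ≤ d)
    (fun c => ∑ v, (monoNbrs G c v).card) ⟨c, hc, hhigh⟩
  refine ⟨c, hc, hasDefect_iff.2 ?_⟩
  by_contra! hbad
  obtain ⟨v, hv⟩ := hbad
  have hlow := lt_of_not_ge (mt (hhigh v) hv.not_ge)
  obtain ⟨γ, hγ, hγv⟩ := exists_mem_forall_adj_ne (G := G) (c := c) (v := v) (S := L v) (by omega)
  have hle (w : V) := Finset.card_le_card (monoNbrs_update_subset_self hγv w)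
  have hempty : monoNbrs G (Function.update c v γ) v = ∅ :=
    Finset.eq_empty_of_forall_notMem fun w hw =>
      hγv w (mem_monoNbrs_update_self.1 hw).1 (mem_monoNbrs_update_self.1 hw).2
  have hlt : ∑ w, (monoNbrs G (Function.update c v γ) w).card < ∑ w, (monoNbrs G c w).card := by
    refine Finset.sum_lt_sum (fun w _ => hle w) ⟨v, Finset.mem_univ v, ?_⟩
    rw [hempty, Finset.card_empty]
    omega
  have hmem := (Function.forall_update_iff c fun w γ => γ ∈ L w).2 ⟨hγ, fun w _ => hc w⟩
  exact hlt.not_ge (hmin ⟨hmem, fun w hw => (hle w).trans (hhigh w hw)⟩ hlt.le)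

/-- The vertices of degree at least `n`. -/
noncomputable def highVertices (G : SimpleGraph V) (n : ℕ) : Finset V :=
  {v | n ≤ (nbrsIn G Finset.univ v).card}

/-- The non-isolated vertices of degree less than `n`. -/
noncomputable def lowVertices (G : SimpleGraph V) (n : ℕ) : Finset V :=
  {v | 0 < (nbrsIn G Finset.univ v).card ∧ (nbrsIn G Finset.univ v).card < n}

@[simp]
theorem mem_highVertices : v ∈ highVertices G n ↔ n ≤ (nbrsIn G Finset.univ v).card := by
  simp [highVertices]

@[simp]
theorem mem_lowVertices : v ∈ lowVertices G n ↔
    0 < (nbrsIn G Finset.univ v).card ∧ (nbrsIn G Finset.univ v).card < n := by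
  simp [lowVertices]

theorem card_nbrsIn_univ_pos (hvw : G.Adj v w) : 0 < (nbrsIn G Finset.univ v).card :=
  Finset.card_pos.2 ⟨w, mem_nbrsIn.2 ⟨Finset.mem_univ w, hvw⟩⟩

theorem mem_highVertices_or_mem_lowVertices (n : ℕ) (hvw : G.Adj v w) :
    v ∈ highVertices G n ∨ v ∈ lowVertices G n := by
  rw [mem_highVertices, mem_lowVertices]
  exact (le_or_gt n _).imp_right fun hlt => ⟨card_nbrsIn_univ_pos hvw, hlt⟩

/-- A vertex whose edges may be deleted in the inductive construction of a colouring from lists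
of size `s` with defect `d`: it has a colour that avoids its neighbours of degree at least `d + s`
and, if it has such a degree itself, is shared with at most `d` of its other neighbours. -/
def IsReducible (G : SimpleGraph V) (s d : ℕ) (v : V) : Prop :=
  (nbrsIn G (highVertices G (d + s)) v).card < s ∧
    (v ∈ highVertices G (d + s) → (nbrsIn G (lowVertices G (d + s)) v).card <
      (s - (nbrsIn G (highVertices G (d + s)) v).card) * (d + 1))

theorem IsReducible.exists_colour [DecidableEq V] (hv : IsReducible G s d v) {S : Finset α}
    (hS : S.card = s) (c : V → α) :
    ∃ γ ∈ S, (∀ w ∈ highVertices G (d + s), G.Adj v w → c w ≠ γ) ∧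
      (v ∈ highVertices G (d + s) → (monoNbrs G (Function.update c v γ) v).card ≤ d) := by
  classical
  obtain ⟨hk, hlow⟩ := hv
  set high := highVertices G (d + s)
  have hcard : s - (nbrsIn G high v).card ≤ (S \ (nbrsIn G high v).image c).card := by
    have hsdiff := Finset.le_card_sdiff ((nbrsIn G high v).image c) S
    have himage := Finset.card_image_le (f := c) (s := nbrsIn G high v)
    omega
  obtain ⟨γ, hγ, hfiber⟩ : ∃ γ ∈ S \ (nbrsIn G high v).image c,
      v ∈ high → {w ∈ nbrsIn G (lowVertices G (d + s)) v | c w = γ}.card ≤ d := by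
    by_cases hvhigh : v ∈ high
    · obtain ⟨γ, hγ, hlt⟩ := Finset.exists_card_fiber_lt_of_card_lt_mul (f := c)
        ((hlow hvhigh).trans_le (Nat.mul_le_mul_right _ hcard))
      exact ⟨γ, hγ, fun _ => Nat.lt_succ_iff.1 hlt⟩
    · obtain ⟨γ, hγ⟩ := Finset.card_pos.1 (hcard.trans_lt' (Nat.sub_pos_of_lt hk))
      exact ⟨γ, hγ, fun h => absurd h hvhigh⟩
  rw [Finset.mem_sdiff, Finset.mem_image] at hγ
  have hγhigh (w : V) (hw : w ∈ high) (hvw : G.Adj v w) : c w ≠ γ :=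
    fun hcw => hγ.2 ⟨w, mem_nbrsIn.2 ⟨hw, hvw⟩, hcw⟩
  refine ⟨γ, hγ.1, hγhigh, fun hvhigh => (Finset.card_le_card fun w hw => ?_).trans (hfiber hvhigh)⟩
  obtain ⟨hvw, hcw⟩ := mem_monoNbrs_update_self.1 hw
  rw [Finset.mem_filter, mem_nbrsIn]
  exact ⟨⟨(mem_highVertices_or_mem_lowVertices _ hvw.symm).resolve_left
    fun hwhigh => hγhigh w hwhigh hvw hcw, hvw⟩, hcw⟩

theorem IsReducible.exists_hasDefect (hv : IsReducible G s d v) {L : V → Finset α}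
    (hL : ∀ v, (L v).card = s) (hc : ∀ v, c v ∈ L v)
    (hdef : HasDefect (G.deleteIncidenceSet v) c d) :
    ∃ c : V → α, (∀ v, c v ∈ L v) ∧ HasDefect G c d := by
  classical
  obtain ⟨γ, hγ, hne, hself⟩ := hv.exists_colour (hL v) c
  refine exists_hasDefect_of_forall_card_monoNbrs_le
    ((Function.forall_update_iff c fun w γ => γ ∈ L w).2 ⟨hγ, fun w _ => hc w⟩) fun w hw => ?_
  rw [hL, ← mem_highVertices] at hw
  rcases eq_or_ne w v with rfl | hwv
  · exact hself hw
  · exact (Finset.card_le_card (monoNbrs_update_subset hwv (hne w hw))).trans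
      (hasDefect_iff.1 hdef w)

theorem isChoosable_of_exists_isReducible {V : Type u} [Fintype V] {P : SimpleGraph V → Prop}
    (hs : 0 < s) (hP : Antitone P)
    (h : ∀ G, P G → G ≠ ⊥ → ∃ v w, G.Adj v w ∧ IsReducible G s d v) (G : SimpleGraph V) (hG : P G) :
    IsChoosable G s d := by
  intro α L hL
  induction G using WellFoundedLT.induction with
  | ind G ih =>
  by_cases hbot : G = ⊥
  · have hne (v : V) : ∃ γ, γ ∈ L v := Finset.card_pos.1 (hs.trans_eq (hL v).symm)
    choose c hc using hne
    exact ⟨c, hc, fun v => by simp [hbot]⟩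
  · obtain ⟨v, w, hvw, hv⟩ := h G hG hbot
    have hlt : G.deleteIncidenceSet v < G := by
      refine lt_of_le_not_ge (G.deleteIncidenceSet_le v) fun hle => ?_
      exact (SimpleGraph.deleteIncidenceSet_adj.1 (hle hvw)).2.1 rfl
    obtain ⟨c, hc, hdef⟩ := ih _ hlt (hP hlt.le hG)
    exact hv.exists_hasDefect hL hc hdef

end Colouring

/-! ### Suppression and edge counts -/

section Suppression

variable {V : Type*} {G G' : SimpleGraph V} {S T : Finset V} {a u v : V}

theorem IsTopologicalMinor.of_isContained {W : Type*} {H : SimpleGraph W} (h : H.IsContained G) :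
    IsTopologicalMinor H G := by
  obtain ⟨f⟩ := h
  refine ⟨f.toEmbedding, fun _ _ h => (f.toHom.map_adj h).toWalk,
    fun _ _ h => .of_adj (f.toHom.map_adj h), fun a b h c hc => ?_,
    fun a b h _ _ _ _ x hx _ => ?_⟩
  · exact (List.mem_pair.1 hc).imp (fun h => f.injective h) fun h => f.injective h
  · exact (List.mem_pair.1 hx).elim (fun h => ⟨a, h⟩) fun h => ⟨b, h⟩

theorem adjPairs_congr (h : ∀ x ∈ S, ∀ y ∈ T, G.Adj x y ↔ G'.Adj x y) :
    adjPairs G S T = adjPairs G' S T := by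
  refine Finset.sum_congr rfl fun x hx => congrArg Finset.card ?_
  ext y
  simp only [mem_nbrsIn]
  exact and_congr_right (h x hx y)

theorem adjPairs_sup_edge (hu : u ∈ S) (hv : v ∈ S) (huv : u ≠ v) (h : ¬G.Adj u v) :
    adjPairs (G ⊔ SimpleGraph.edge u v) S S = adjPairs G S S + 2 := by
  classical
  have hnbrs : nbrsIn (G ⊔ SimpleGraph.edge u v) S u = insert v (nbrsIn G S u) := by
    ext y
    simp only [mem_nbrsIn, Finset.mem_insert, SimpleGraph.sup_adj, SimpleGraph.edge_adj]
    grind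
  have herase : adjPairs (G ⊔ SimpleGraph.edge u v) (S.erase u) (S.erase u) =
      adjPairs G (S.erase u) (S.erase u) := by
    refine adjPairs_congr fun x hx y hy => ?_
    simp only [SimpleGraph.sup_adj, SimpleGraph.edge_adj, Finset.ne_of_mem_erase hx,
      Finset.ne_of_mem_erase hy, false_and, and_false, or_false]
  rw [← adjPairs_erase_add hu, ← adjPairs_erase_add hu, herase, hnbrs,
    Finset.card_insert_of_notMem fun hmem => h (mem_nbrsIn.1 hmem).2]
  ring

theorem adjPairs_suppress (ha : a ∉ S) (hu : u ∈ S) (hv : v ∈ S) (huv : u ≠ v)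
    (h : ¬G.Adj u v) : adjPairs (suppress G a u v) S S = adjPairs G S S + 2 := by
  rw [suppress, adjPairs_sup_edge hu hv huv fun h' => h (G.deleteIncidenceSet_le a h')]
  congr 1
  refine adjPairs_congr fun x hx y hy => ?_
  rw [SimpleGraph.deleteIncidenceSet_adj]
  exact and_iff_left ⟨ne_of_mem_of_not_mem hx ha, ne_of_mem_of_not_mem hy ha⟩

variable {V : Type u} {G : SimpleGraph V} {S A B Z : Finset V} {a : V}
  {s : ℕ} {C : GraphClass.{u}}

theorem IsIntermediateClass.cliqueFree (hC : IsIntermediateClass s C) (hG : C V G) :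
    G.CliqueFree (s + 1) := by
  by_contra h
  exact hC.not_isTopologicalMinor hG
    (.of_isContained ((SimpleGraph.not_cliqueFree_iff_top_isContained _).1 h))

theorem IsIntermediateClass.exists_adjPairs_eq_add_two (hC : IsIntermediateClass s C) (hG : C V G)
    (ha : a ∉ S) (hs : s ≤ (nbrsIn G S a).card) :
    ∃ G', C V G' ∧ G.deleteIncidenceSet a ≤ G' ∧ adjPairs G' S S = adjPairs G S S + 2 := by
  classical
  obtain ⟨T, hT, hcard⟩ := Finset.exists_subset_card_eq hs
  have hTS (x : V) (hx : x ∈ T) : x ∈ S ∧ G.Adj a x := mem_nbrsIn.1 (hT hx)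
  obtain ⟨u, hu, v, hv, huv, hadj⟩ : ∃ u ∈ T, ∃ v ∈ T, u ≠ v ∧ ¬G.Adj u v := by
    by_contra! hclique
    have hT : G.IsNClique s T := ⟨fun x hx y hy => hclique x hx y hy, hcard⟩
    exact hC.cliqueFree hG _ (hT.insert fun x hx => (hTS x hx).2)
  exact ⟨_, hC.suppress huv (hTS u hu).2 (hTS v hv).2 hG, le_sup_left,
    adjPairs_suppress ha (hTS u hu).1 (hTS v hv).1 huv hadj⟩

theorem IsIntermediateClass.exists_adjPairs_eq_add_two_mul_card (hC : IsIntermediateClass s C)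
    (hG : C V G) (hAB : Disjoint A B) (hA : ∀ a ∈ A, s ≤ (nbrsIn G B a).card) :
    ∃ G', C V G' ∧ adjPairs G' B B = adjPairs G B B + 2 * A.card := by
  classical
  induction A using Finset.induction generalizing G with
  | empty => exact ⟨G, hG, rfl⟩
  | insert a A haA ih =>
    rw [Finset.disjoint_insert_left] at hAB
    obtain ⟨G', hG', hle, hadd⟩ :=
      hC.exists_adjPairs_eq_add_two hG hAB.1 (hA a (Finset.mem_insert_self a A))
    have hG'A (b : V) (hb : b ∈ A) : s ≤ (nbrsIn G' B b).card := by
      refine (hA b (Finset.mem_insert_of_mem hb)).trans (Finset.card_le_card fun x hx => ?_)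
      rw [mem_nbrsIn] at hx ⊢
      exact ⟨hx.1, hle (SimpleGraph.deleteIncidenceSet_adj.2
        ⟨hx.2, ne_of_mem_of_not_mem hb haA, ne_of_mem_of_not_mem hx.1 hAB.1⟩)⟩
    obtain ⟨G'', hG'', hadd'⟩ := ih hG' hAB.2 hG'A
    refine ⟨G'', hG'', ?_⟩
    rw [hadd', hadd, Finset.card_insert_of_notMem haA]
    ring

theorem IsIntermediateClass.adjPairs_add_two_mul_le {t : ℕ} (hC : IsIntermediateClass (t + 1) C)
    (ht : 1 ≤ t) (ht2 : t ≤ 2) (hG : C V G) (hZ : Z.Nonempty) :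
    adjPairs G Z Z + 2 * t ≤ 2 * t * Z.card := by
  classical
  induction hn : Z.card + adjPairs G Z Z using Nat.strong_induction_on generalizing Z G with
  | _ n ih =>
  by_cases hdeg : ∀ v ∈ Z, t + 2 ≤ (nbrsIn G Z v).card
  · obtain ⟨u, hu⟩ := hZ
    obtain ⟨v, hv⟩ := Finset.card_pos.1 ((Nat.succ_pos _).trans_le (hdeg u hu))
    rw [mem_nbrsIn] at hv
    have hdelete := adjPairs_sup_edge (G := G \ SimpleGraph.edge u v) hu hv.1 hv.2.ne
      (by simp [SimpleGraph.edge_adj, hv.2.ne])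
    rw [sdiff_sup_cancel ((SimpleGraph.edge_le_iff G).2 (.inr hv.2))] at hdelete
    have hih := ih _ (by omega)
      (hC.mono (sdiff_le : G \ SimpleGraph.edge u v ≤ G) hG) ⟨u, hu⟩ rfl
    have hmany := card_mul_le_adjPairs hdeg
    interval_cases t <;> omega
  · push Not at hdeg
    obtain ⟨v, hv, hlt⟩ := hdeg
    have herase := adjPairs_erase_add (G := G) hv
    have hcard := Finset.card_erase_add_one hv
    rcases (Z.erase v).eq_empty_or_nonempty with hempty | hne
    · obtain rfl : Z = {v} :=
        ((Finset.erase_eq_empty_iff Z v).1 hempty).resolve_left (Finset.ne_empty_of_mem hv)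
      simp [adjPairs_singleton_self]
    rw [← hcard, mul_add_one]
    rcases Nat.lt_or_ge t (nbrsIn G Z v).card with hgt | hle
    · obtain ⟨G', hG', -, hadd⟩ := hC.exists_adjPairs_eq_add_two hG (Finset.notMem_erase v Z)
        (by rw [nbrsIn_erase]; exact hgt)
      have hih := ih _ (by omega) hG' hne rfl
      omega
    · have hih := ih _ (by omega) hG hne rfl
      omega

end Suppression

/-! ### Reducible vertices in sparse graphs -/

section Irreducible

variable {V : Type*} [Fintype V] {G : SimpleGraph V} {s d : ℕ} {v : V}

theorem disjoint_lowVertices_highVertices (G : SimpleGraph V) (n : ℕ) :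
    Disjoint (lowVertices G n) (highVertices G n) :=
  Finset.disjoint_left.2 fun _ hlow hhigh =>
    (mem_lowVertices.1 hlow).2.not_ge (mem_highVertices.1 hhigh)

theorem card_nbrsIn_lowVertices_add (G : SimpleGraph V) (n : ℕ) (v : V) :
    (nbrsIn G (lowVertices G n) v).card + (nbrsIn G (highVertices G n) v).card =
      (nbrsIn G Finset.univ v).card := by
  classical
  rw [← card_nbrsIn_union (disjoint_lowVertices_highVertices G n)]
  congr 1
  ext w
  rw [mem_nbrsIn, mem_nbrsIn, Finset.mem_union]
  exact and_congr_left fun hvw => iff_of_true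
    (mem_highVertices_or_mem_lowVertices n hvw.symm).symm (Finset.mem_univ w)

theorem le_card_nbrsIn_highVertices (hv : v ∈ lowVertices G (d + s))
    (hirr : ∀ v w, G.Adj v w → ¬IsReducible G s d v) :
    s ≤ (nbrsIn G (highVertices G (d + s)) v).card := by
  by_contra! hlt
  obtain ⟨w, hw⟩ := Finset.card_pos.1 (mem_lowVertices.1 hv).1
  exact hirr v w (mem_nbrsIn.1 hw).2 ⟨hlt, fun hhigh =>
    absurd hhigh (Finset.disjoint_left.1 (disjoint_lowVertices_highVertices G _) hv)⟩

theorem mul_le_card_nbrsIn_add (hirr : ¬IsReducible G s d v) :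
    s * (d + 1) ≤ (nbrsIn G (lowVertices G (d + s)) v).card +
      (nbrsIn G (highVertices G (d + s)) v).card * (d + 1) := by
  rcases le_or_gt s (nbrsIn G (highVertices G (d + s)) v).card with hle | hlt
  · exact (Nat.mul_le_mul_right _ hle).trans (Nat.le_add_left _ _)
  · have hlow := not_lt.1 fun hlow => hirr ⟨hlt, fun _ => hlow⟩
    rw [Nat.sub_mul] at hlow
    omega

theorem highVertices_nonempty (hs : 0 < s) (hbot : G ≠ ⊥)
    (hirr : ∀ v w, G.Adj v w → ¬IsReducible G s d v) : (highVertices G (d + s)).Nonempty := by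
  obtain ⟨v, w, hvw⟩ := SimpleGraph.ne_bot_iff_exists_adj.1 hbot
  rcases mem_highVertices_or_mem_lowVertices (d + s) hvw with hv | hv
  · exact ⟨v, hv⟩
  · obtain ⟨u, hu⟩ := Finset.card_pos.1 (hs.trans_le (le_card_nbrsIn_highVertices hv hirr))
    exact ⟨u, (mem_nbrsIn.1 hu).1⟩

theorem mul_card_highVertices_le (G : SimpleGraph V) (n : ℕ) :
    n * (highVertices G n).card ≤ adjPairs G (highVertices G n) (lowVertices G n) +
      adjPairs G (highVertices G n) (highVertices G n) := by
  rw [adjPairs, adjPairs, ← Finset.sum_add_distrib, mul_comm, ← smul_eq_mul]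
  refine Finset.card_nsmul_le_sum _ _ _ fun v hv => ?_
  rw [card_nbrsIn_lowVertices_add]
  exact mem_highVertices.1 hv

theorem mul_mul_card_highVertices_le (hs : 0 < s)
    (hirr : ∀ v w, G.Adj v w → ¬IsReducible G s d v) :
    s * (d + 1) * (highVertices G (d + s)).card ≤
      adjPairs G (highVertices G (d + s)) (lowVertices G (d + s)) +
        adjPairs G (highVertices G (d + s)) (highVertices G (d + s)) * (d + 1) := by
  rw [adjPairs, adjPairs, Finset.sum_mul, ← Finset.sum_add_distrib, mul_comm, ← smul_eq_mul]
  refine Finset.card_nsmul_le_sum _ _ _ fun v hv => ?_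
  obtain ⟨w, hw⟩ := Finset.card_pos.1 ((Nat.add_pos_right d hs).trans_le (mem_highVertices.1 hv))
  exact mul_le_card_nbrsIn_add (hirr v w (mem_nbrsIn.1 hw).2)

theorem two_mul_adjPairs_add_le [DecidableEq V] (G : SimpleGraph V) (n : ℕ) :
    2 * adjPairs G (highVertices G n) (lowVertices G n) +
        adjPairs G (highVertices G n) (highVertices G n) ≤
      adjPairs G (lowVertices G n ∪ highVertices G n) (lowVertices G n ∪ highVertices G n) := by
  rw [adjPairs_union_self (disjoint_lowVertices_highVertices G n), adjPairs_comm]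
  omega

end Irreducible

/-- Here `b`, `a` and `x` are the numbers of high vertices, of low vertices and of edges between
them in a graph without reducible vertices; `m` is twice the number of edges between high
vertices. -/
theorem not_density_inequalities {s δ d a b x m : ℝ} (hs : 4 ≤ s) (hδ : s - 1 ≤ δ)
    (hd : δ * (2 * δ - s + 1) < d + s) (hb : 0 < b) (hdeg : (d + s) * b ≤ x + m)
    (hirr : s * (d + 1) * b ≤ x + m * (d + 1)) (hedges : 2 * x + m ≤ 2 * (δ * (a + b)))
    (hsuppress : m + 2 * a ≤ 2 * (δ * b)) : False := by
  have hx : 2 * x ≤ (δ + 1) * (2 * (δ * b) - m) := by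
    nlinarith [mul_le_mul_of_nonneg_left hsuppress (by linarith : 0 ≤ δ)]
  obtain ⟨q, hq⟩ : ∃ q, q = s * b - m := ⟨_, rfl⟩
  obtain ⟨p, hp⟩ : ∃ p, p = 2 * δ ^ 2 - s * (δ + 1) := ⟨_, rfl⟩
  have hple : δ - 1 ≤ p := by
    nlinarith [mul_le_mul_of_nonneg_right hδ (by linarith : 0 ≤ δ + 1),
      mul_nonneg (by linarith : 0 ≤ δ) (by linarith : 0 ≤ δ - 3)]
  have hdb : (p + δ + s) * b < (d + s) * b := by
    refine mul_lt_mul_of_pos_right ?_ hb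
    linarith
  have hpq : p * b < (δ - 1) * q := by
    rw [hq]
    nlinarith
  have hqpos : 0 < q :=
    pos_of_mul_pos_right ((mul_pos (by linarith) hb).trans hpq) (by linarith)
  have hqb : (2 * p + δ + 1) * q < (p + 2 * δ) * b := by
    have hdq : (p + δ + 1) * q < (d + 1) * q := by
      refine mul_lt_mul_of_pos_right ?_ hqpos
      linarith
    nlinarith
  have hpp : (p * (p + 1)) * b < (δ * (δ - 1)) * b := by
    nlinarith
  nlinarith [lt_of_mul_lt_mul_right hpp hb.le]

theorem not_edge_inequalities {t d a b x m : ℕ} (ht : 1 ≤ t) (ht2 : t ≤ 2) (hd : t ^ 2 ≤ d + t)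
    (hb : 0 < b) (hdeg : (d + (t + 1)) * b ≤ x + m)
    (hirr : (t + 1) * (d + 1) * b ≤ x + m * (d + 1)) (hedges : 2 * x + m + 2 * t ≤ 2 * t * (a + b))
    (hsuppress : m + 2 * a ≤ 2 * t * b) : False := by
  obtain rfl | rfl : t = 1 ∨ t = 2 := by omega
  · nlinarith
  · have hdeg' := Nat.mul_le_mul_left (2 * d - 1) hdeg
    zify [show 1 ≤ 2 * d by omega] at *
    nlinarith

section Sparse

variable {V : Type u} [Fintype V] {G : SimpleGraph V} {s d : ℕ} {δ : ℝ} {C : GraphClass.{u}}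

theorem IsIntermediateClass.exists_isReducible_of_four_le (hC : IsIntermediateClass s C)
    (hs : 4 ≤ s) (hδ : δ ∈ upperBounds (densities C)) (hd : δ * (2 * δ - s + 1) < d + s)
    (hG : C V G) (hbot : G ≠ ⊥) : ∃ v w, G.Adj v w ∧ IsReducible G s d v := by
  classical
  by_contra! hirr
  have hs0 : 0 < s := by omega
  have hs' : (4 : ℝ) ≤ s := by exact_mod_cast hs
  have hpos : (0 : ℝ) < (highVertices G (d + s)).card := by
    exact_mod_cast (highVertices_nonempty hs0 hbot hirr).card_pos
  have hdeg := mul_card_highVertices_le G (d + s)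
  have hlists := mul_mul_card_highVertices_le hs0 hirr
  have hunion := two_mul_adjPairs_add_le G (d + s)
  have hdisj := disjoint_lowVertices_highVertices G (d + s)
  have hedges := hC.adjPairs_le hδ hG (lowVertices G (d + s) ∪ highVertices G (d + s))
  obtain ⟨G', hG', hadd⟩ := hC.exists_adjPairs_eq_add_two_mul_card hG hdisj
    fun a ha => le_card_nbrsIn_highVertices ha hirr
  have hsuppress := hC.adjPairs_le hδ hG' (highVertices G (d + s))
  rw [Finset.card_union_of_disjoint hdisj] at hedges
  rify at hdeg hlists hunion hadd
  push_cast at hedges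
  exact not_density_inequalities hs' (hC.le_of_mem_upperBounds_densities hs0 hδ) hd hpos
    (a := (lowVertices G (d + s)).card) hdeg hlists (by linarith) (by linarith)

theorem IsIntermediateClass.exists_isReducible_of_le_two {t : ℕ}
    (hC : IsIntermediateClass (t + 1) C) (ht : 1 ≤ t) (ht2 : t ≤ 2) (hd : t ^ 2 ≤ d + t)
    (hG : C V G) (hbot : G ≠ ⊥) : ∃ v w, G.Adj v w ∧ IsReducible G (t + 1) d v := by
  classical
  by_contra! hirr
  have hhigh := highVertices_nonempty t.add_one_pos hbot hirr
  have hunion := two_mul_adjPairs_add_le G (d + (t + 1))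
  have hdisj := disjoint_lowVertices_highVertices G (d + (t + 1))
  have hedges := hC.adjPairs_add_two_mul_le ht ht2 hG
    (hhigh.mono (Finset.subset_union_right (s₁ := lowVertices G (d + (t + 1)))))
  obtain ⟨G', hG', hadd⟩ := hC.exists_adjPairs_eq_add_two_mul_card hG hdisj
    fun a ha => le_card_nbrsIn_highVertices ha hirr
  have hsuppress := hC.adjPairs_add_two_mul_le ht ht2 hG' hhigh
  rw [Finset.card_union_of_disjoint hdisj] at hedges
  exact not_edge_inequalities ht ht2 hd hhigh.card_pos (a := (lowVertices G (d + (t + 1))).card)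
    (mul_card_highVertices_le G _) (mul_mul_card_highVertices_le t.add_one_pos hirr)
    (by omega) (by omega)

end Sparse

/-! ### Choosability -/

section Choosability

variable {s : ℕ} {C : GraphClass.{u}}

theorem IsIntermediateClass.densities_nonempty (hC : IsIntermediateClass s C) (hs : 1 ≤ s) :
    (densities C).Nonempty := by
  refine ⟨_, PUnit, inferInstance, inferInstance, ⊥, hC.of_not_isMinor ?_, rfl⟩
  refine not_isMinor_top_of_isVertexCover (T := ∅) (fun _ _ h => h.elim) ?_
  simp only [Set.encard_empty, zero_add, ENat.card_eq_coe_fintype_card, Fintype.card_fin]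
  exact_mod_cast Nat.lt_add_one_of_le hs

theorem sq_le_mul_two_mul_sub {t δ : ℝ} (ht : 0 ≤ t) (hδ : t ≤ δ) : t ^ 2 ≤ δ * (2 * δ - t) := by
  nlinarith

theorem exists_natCast_eq_floor_sub_add_one {s : ℕ} {x : ℝ} (h : (s : ℝ) - 1 ≤ x) :
    ∃ d : ℕ, (d : ℤ) = ⌊x⌋ - s + 1 ∧ x < d + s := by
  have hfloor : (s : ℤ) - 1 ≤ ⌊x⌋ := Int.le_floor.2 (by exact_mod_cast h)
  obtain ⟨d, hd⟩ := Int.eq_ofNat_of_zero_le (show 0 ≤ ⌊x⌋ - s + 1 by omega)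
  refine ⟨d, hd.symm, (Int.lt_floor_add_one x).trans_eq ?_⟩
  rw [show ⌊x⌋ = d + s - 1 by omega]
  push_cast
  ring

theorem IsIntermediateClass.isChoosable (hC : IsIntermediateClass s C) (hs : 2 ≤ s) {δ : ℝ}
    (hδ : δ ∈ upperBounds (densities C)) {d : ℕ} (hd : δ * (2 * δ - s + 1) < d + s)
    {V : Type u} [Finite V] {G : SimpleGraph V} (hG : C V G) : IsChoosable G s d := by
  have := Fintype.ofFinite V
  refine isChoosable_of_exists_isReducible (P := C V) (by omega) (fun _ _ h => hC.mono h)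
    (fun G hG hbot => ?_) G hG
  rcases le_or_gt 4 s with hs4 | hs4
  · exact hC.exists_isReducible_of_four_le hs4 hδ hd hG hbot
  · obtain ⟨t, rfl⟩ := Nat.exists_eq_add_of_le' (one_le_two.trans hs)
    refine hC.exists_isReducible_of_le_two (by omega) (by omega) ?_ hG hbot
    have htδ := hC.le_of_mem_upperBounds_densities (by omega) hδ
    push_cast at hd htδ
    have hlt : (t : ℝ) ^ 2 < d + (t + 1) :=
      (sq_le_mul_two_mul_sub t.cast_nonneg (by linarith)).trans_lt (by linarith)
    exact Nat.lt_succ_iff.1 (by exact_mod_cast hlt)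

theorem mainTheorem2_general (hC : IsIntermediateClass s C) (hs : 2 ≤ s) :
    HasDefectiveChromaticNumber C s ∧ HasDefectiveChoiceNumber C s ∧
      ∃ δ : ℝ, IsLUB (densities C) δ ∧
        ∃ d : ℕ, (d : ℤ) = ⌊δ * (2 * δ - s + 1)⌋ - s + 1 ∧
          ∀ (V : Type u) [Finite V] (G : SimpleGraph V), C V G → IsChoosable G s d := by
  have hs1 : 1 ≤ s := by omega
  have hδ := isLUB_csSup (hC.densities_nonempty hs1) hC.bddAbove_densities
  set δ := sSup (densities C)
  have hsδ := hC.le_of_mem_upperBounds_densities hs1 hδ.1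
  have hs' : (1 : ℝ) ≤ s - 1 := by
    have : (2 : ℝ) ≤ s := by exact_mod_cast hs
    linarith
  obtain ⟨d, hd, hlt⟩ := exists_natCast_eq_floor_sub_add_one (s := s) (x := δ * (2 * δ - s + 1)) <|
    calc (s : ℝ) - 1 ≤ (s - 1) ^ 2 := le_self_pow₀ hs' two_ne_zero
      _ ≤ δ * (2 * δ - (s - 1)) := sq_le_mul_two_mul_sub (by linarith) hsδ
      _ = δ * (2 * δ - s + 1) := by ring
  have hchoosable (V : Type u) [Finite V] (G : SimpleGraph V) (hG : C V G) : IsChoosable G s d :=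
    hC.isChoosable hs hδ.1 hlt hG
  obtain ⟨hchromatic, hchoice⟩ := hC.hasDefectiveNumbers hchoosable
  exact ⟨hchromatic, hchoice, δ, hδ, d, hd, hchoosable⟩

end Choosability

end DefectiveColouring

open DefectiveColouring in
theorem mainTheorem2 (s : ℕ) (hs : 2 ≤ s) :
    (HasDefectiveChromaticNumber (minorFree.{u} (⊤ : SimpleGraph (Fin (s + 1)))) s ∧
      HasDefectiveChoiceNumber (minorFree.{u} (⊤ : SimpleGraph (Fin (s + 1)))) s ∧
      ∃ δ : ℝ, IsLUB (densities (minorFree.{u} (⊤ : SimpleGraph (Fin (s + 1))))) δ ∧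
        ∃ d : ℕ, (d : ℤ) = ⌊δ * (2 * δ - s + 1)⌋ - s + 1 ∧
          ∀ (V : Type u) [Finite V] (G : SimpleGraph V),
            minorFree (⊤ : SimpleGraph (Fin (s + 1))) V G → IsChoosable G s d) ∧
    (HasDefectiveChromaticNumber (topologicalMinorFree.{u} (⊤ : SimpleGraph (Fin (s + 1)))) s ∧
      HasDefectiveChoiceNumber (topologicalMinorFree.{u} (⊤ : SimpleGraph (Fin (s + 1)))) s ∧
      ∃ δ : ℝ, IsLUB (densities (topologicalMinorFree.{u} (⊤ : SimpleGraph (Fin (s + 1))))) δ ∧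
        ∃ d : ℕ, (d : ℤ) = ⌊δ * (2 * δ - s + 1)⌋ - s + 1 ∧
          ∀ (V : Type u) [Finite V] (G : SimpleGraph V),
            topologicalMinorFree (⊤ : SimpleGraph (Fin (s + 1))) V G → IsChoosable G s d) :=
  ⟨mainTheorem2_general (isIntermediateClass_minorFree (by omega)) hs,
    mainTheorem2_general (isIntermediateClass_topologicalMinorFree (by omega)) hs⟩
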